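/- **Theorem (shape identification by the GLSM indicator).** Let $d\in\{1,2\}$, $B=\{x\in\mathbb R^d:|x|<1\}$, $c>0$, and let $\Omega\subset B$ be a nonempty open set. Let $q\in L^\infty(\mathbb R^d)$ be real-valued with $q=0$ a.e. outside $\Omega$ and $0<q_{\inf}\le q\le q_{\sup}$ a.e. in $\Omega$ for some constants $q_{\inf},q_{\sup}$. Let $$u(x)=\int_B e^{i2c\,x\cdot y}q(y)\,dy,\qquad (\mathcal N g)(t)=\int_B u\Big(\frac{t-s}{2}\Big)g(s)\,ds,\qquad \mathcal N:L^2(B)\to L^2(B),$$ with $L^2(B)$ complex and $\langle f,g\rangle=\int_B f\,\overline g$, $\|f\|^2=\langle f,f\rangle$. Then $\mathcal N$ has an eigensystem $\{\zeta_n,\mu_n\}_{n\ge 0}$, that is, a complete orthonormal sequence $(\zeta_n)$ in $L^2(B)$ with $\mathcal N\zeta_n=\mu_n\zeta_n$ and $\mu_0\ge\mu_1\ge\cdots>0$. For every such eigensystem the following holds. Let $f_\alpha:(0,\infty)\to\mathbb R$ $(\alpha>0)$ be bounded functions with $\lim_{\alpha\to0^+}f_\alpha(\mu)=1/\mu$ for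 all $\mu>0$, and suppose that for some constant $d_0>0$ we have $|\mu f_\alpha(\mu)|\le d_0$ for all $\alpha>0$ and $\mu>0$. Put $$\mathcal R_\alpha h=\sum_{n=0}^\infty f_\alpha(\mu_n^2)\,\mu_n\,\langle h,\zeta_n\rangle\,\zeta_n .$$ Let $R\subset\mathbb R^d$ be a nonempty measurable sampling region $R=R(z,\epsilon)$ with $R\subset\overline{\operatorname{int}R}$ (for example an open interval, square or disk around a sampling point $z$) and $\overline R\subset B$. Put $$\phi_z(t)=\frac1{|R|}\int_{R}e^{ic\,t\cdot y}\,dy\quad(t\in B),\qquad g_{z,\alpha}=\mathcal R_\alpha\phi_z .$$ 1. If $\overline R\subset\Omega$, then $\langle g_{z,\alpha},\mathcal N g_{z,\alpha}\rangle$ is bounded, uniformly in $\alpha>0$; the equation $\mathcal N^{1/2}g_z^{FM}=\phi_z$ has a unique solution $g_z^{FM}\in L^2(B)$, and $$\lim_{\alpha\to0^+}\langle g_{z,\alpha},\mathcal N g_{z,\alpha}\rangle=\|g_z^{FM}\|^2 .$$ 2. If $R\not\subset\overline\Omega$, then $\langle g_{z,\alpha},\mathcal N g_{z,\alpha}\rangle$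 is real for all $\alpha>0$ and $\lim_{\alpha\to0^+}\langle g_{z,\alpha},\mathcal N g_{z,\alpha}\rangle=+\infty$. -/

import Mathlib

open Set Filter Topology MeasureTheory

noncomputable section

namespace GLSM

/-- The unit interval (`d = 1`) or unit disk (`d = 2`). -/
abbrev unitBall (d : ℕ) : Set (EuclideanSpace ℝ (Fin d)) := Metric.ball 0 1

/-- The complex Hilbert space `L²(B)`. Mathlib's `inner ℂ f g` is conjugate linear in `f`, so the
inner product `∫ f conj(g)` with conjugation in the second function is `inner ℂ g f`. -/
abbrev L2B (d : ℕ) : Type := Lp ℂ 2 (volume.restrict (unitBall d))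

/-- The data `u(x) = ∫_B exp(2 i c x·y) q(y) dy`. -/
def data {d : ℕ} (c : ℝ) (q : EuclideanSpace ℝ (Fin d) → ℝ) (x : EuclideanSpace ℝ (Fin d)) : ℂ :=
  ∫ y in unitBall d, Complex.exp (Complex.I * ((2 * c * inner ℝ x y : ℝ) : ℂ)) * (q y : ℂ)

/-- `E = 1_R / |R|`. -/
def normalizedIndicator {d : ℕ} (R : Set (EuclideanSpace ℝ (Fin d))) :
    EuclideanSpace ℝ (Fin d) → ℂ :=
  R.indicator (fun _ => ((1 / (volume R).toReal : ℝ) : ℂ))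

/-- The function `φ(t) = ∫_{ℝ^d} exp(i c t·y) E(y) dy`. -/
def testFun {d : ℕ} (c : ℝ) (R : Set (EuclideanSpace ℝ (Fin d)))
    (t : EuclideanSpace ℝ (Fin d)) : ℂ :=
  ∫ y, Complex.exp (Complex.I * ((c * inner ℝ t y : ℝ) : ℂ)) * normalizedIndicator R y

section Aux

variable {d : ℕ}

theorem norm_expI (r : ℝ) : ‖Complex.exp (Complex.I * (r : ℂ))‖ = 1 := by
  rw [mul_comm]; exact Complex.norm_exp_ofReal_mul_I r

theorem norm_expTransform_le (ν : Measure (EuclideanSpace ℝ (Fin d))) (a : ℝ)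
    (w : EuclideanSpace ℝ (Fin d) → ℂ) (x : EuclideanSpace ℝ (Fin d)) :
    ‖∫ y, Complex.exp (Complex.I * ((a * inner ℝ x y : ℝ) : ℂ)) * w y ∂ν‖ ≤ ∫ y, ‖w y‖ ∂ν := by
  refine (norm_integral_le_integral_norm _).trans (le_of_eq ?_)
  simp only [norm_mul, norm_expI, one_mul]

theorem continuous_expTransform (ν : Measure (EuclideanSpace ℝ (Fin d))) (a : ℝ)
    (w : EuclideanSpace ℝ (Fin d) → ℂ) :
    Continuous fun x : EuclideanSpace ℝ (Fin d) =>
      ∫ y, Complex.exp (Complex.I * ((a * inner ℝ x y : ℝ) : ℂ)) * w y ∂ν := by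
  have key : ∀ (b : ℝ) (x : EuclideanSpace ℝ (Fin d)),
      Continuous fun y => Complex.exp (Complex.I * ((b * inner ℝ x y : ℝ) : ℂ)) := by
    intro b x; fun_prop
  by_cases hw : Integrable w ν
  · refine continuous_of_dominated (bound := fun y => ‖w y‖) ?_ ?_ hw.norm ?_
    · intro x
      exact (key a x).aestronglyMeasurable.mul hw.aestronglyMeasurable
    · intro x
      exact Eventually.of_forall fun y => by rw [norm_mul, norm_expI, one_mul]
    · exact Eventually.of_forall fun y => by fun_prop
  · have : ∀ x : EuclideanSpace ℝ (Fin d),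
        ∫ y, Complex.exp (Complex.I * ((a * inner ℝ x y : ℝ) : ℂ)) * w y ∂ν = 0 := by
      intro x
      refine integral_undef fun h => hw ?_
      have h2 := h.bdd_mul (c := 1) (key (-a) x).aestronglyMeasurable
        (Eventually.of_forall fun y => (norm_expI _).le)
      refine h2.congr (Eventually.of_forall fun y => ?_)
      simp only
      rw [← mul_assoc, ← Complex.exp_add]
      simp
    simp only [this]
    exact continuous_const

theorem continuous_data (c : ℝ) (q : EuclideanSpace ℝ (Fin d) → ℝ) : Continuous (data c q) :=
  continuous_expTransform _ (2 * c) fun y => (q y : ℂ)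

theorem norm_data_le (c : ℝ) (q : EuclideanSpace ℝ (Fin d) → ℝ)
    (x : EuclideanSpace ℝ (Fin d)) :
    ‖data c q x‖ ≤ ∫ y in unitBall d, ‖(q y : ℂ)‖ :=
  norm_expTransform_le _ (2 * c) (fun y => (q y : ℂ)) x

instance : IsFiniteMeasure (volume.restrict (unitBall d)) :=
  ⟨by rw [Measure.restrict_apply_univ]; exact measure_ball_lt_top⟩

theorem memLp_testFun (c : ℝ) (R : Set (EuclideanSpace ℝ (Fin d))) :
    MemLp (testFun c R) 2 (volume.restrict (unitBall d)) :=
  MemLp.of_bound (continuous_expTransform _ c _).aestronglyMeasurable _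
    (Eventually.of_forall (norm_expTransform_le _ c _))

theorem integrable_L2B (g : L2B d) : Integrable g (volume.restrict (unitBall d)) :=
  (Lp.memLp g).integrable (by norm_num)

theorem integrable_kernel (c : ℝ) (q : EuclideanSpace ℝ (Fin d) → ℝ) (g : L2B d)
    (t : EuclideanSpace ℝ (Fin d)) :
    Integrable (fun s => data c q ((1 / 2 : ℝ) • (t - s)) * g s)
      (volume.restrict (unitBall d)) :=
  (integrable_L2B g).bdd_mul (c := ∫ y in unitBall d, ‖(q y : ℂ)‖)
    ((continuous_data c q).comp (by fun_prop)).aestronglyMeasurable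
    (Eventually.of_forall fun _ => norm_data_le c q _)

theorem norm_kernel_integral_le (c : ℝ) (q : EuclideanSpace ℝ (Fin d) → ℝ) (g : L2B d)
    (t : EuclideanSpace ℝ (Fin d)) :
    ‖∫ s in unitBall d, data c q ((1 / 2 : ℝ) • (t - s)) * g s‖ ≤
      (∫ y in unitBall d, ‖(q y : ℂ)‖) * ∫ s in unitBall d, ‖g s‖ := by
  rw [← integral_const_mul]
  refine norm_integral_le_of_norm_le ((integrable_L2B g).norm.const_mul _) ?_
  exact Eventually.of_forall fun s => by
    rw [norm_mul]
    exact mul_le_mul_of_nonneg_right (norm_data_le c q _) (norm_nonneg _)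

theorem memLp_kernel_integral (c : ℝ) (q : EuclideanSpace ℝ (Fin d) → ℝ) (g : L2B d) :
    MemLp (fun t => ∫ s in unitBall d, data c q ((1 / 2 : ℝ) • (t - s)) * g s) 2
      (volume.restrict (unitBall d)) := by
  refine MemLp.of_bound (Continuous.aestronglyMeasurable ?_) _
    (Eventually.of_forall (norm_kernel_integral_le c q g))
  refine continuous_of_dominated
    (bound := fun s => (∫ y in unitBall d, ‖(q y : ℂ)‖) * ‖g s‖) ?_ ?_
    ((integrable_L2B g).norm.const_mul _) ?_
  · exact fun t => (integrable_kernel c q g t).aestronglyMeasurable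
  · exact fun t => Eventually.of_forall fun s => by
      rw [norm_mul]
      exact mul_le_mul_of_nonneg_right (norm_data_le c q _) (norm_nonneg _)
  · exact Eventually.of_forall fun s =>
      ((continuous_data c q).comp (by fun_prop)).mul continuous_const

theorem exists_integral_norm_le (d : ℕ) :
    ∃ K : ℝ, 0 ≤ K ∧ ∀ g : L2B d, ∫ s in unitBall d, ‖g s‖ ≤ K * ‖g‖ := by
  refine ⟨((volume.restrict (unitBall d)) univ ^ (1 / (1 : ENNReal).toReal -
    1 / (2 : ENNReal).toReal)).toReal, ENNReal.toReal_nonneg, fun g => ?_⟩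
  have h := eLpNorm_le_eLpNorm_mul_rpow_measure_univ (p := 1) (q := 2)
    (by norm_num) (Lp.memLp g).1
  have h1 : ∫ s in unitBall d, ‖g s‖ = (eLpNorm g 1 (volume.restrict (unitBall d))).toReal := by
    rw [eLpNorm_one_eq_lintegral_enorm, integral_norm_eq_lintegral_enorm (Lp.memLp g).1]
  rw [h1, Lp.norm_def, mul_comm, ← ENNReal.toReal_mul]
  refine ENNReal.toReal_mono (ENNReal.mul_ne_top (Lp.memLp g).2.ne ?_) h
  exact ENNReal.rpow_ne_top_of_nonneg (by norm_num) (measure_ne_top _ _)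

end Aux

/-- The element `φ` of `L²(B)`. -/
def phi {d : ℕ} (c : ℝ) (R : Set (EuclideanSpace ℝ (Fin d))) : L2B d :=
  (memLp_testFun c R).toLp (testFun c R)

/-- The data operator `(N g)(t) = ∫_B u((t - s)/2) g(s) ds` on `L²(B)`. -/
def dataOperator {d : ℕ} (c : ℝ) (q : EuclideanSpace ℝ (Fin d) → ℝ) : L2B d →L[ℂ] L2B d :=
  LinearMap.mkContinuousOfExistsBound
    { toFun := fun g => (memLp_kernel_integral c q g).toLp
        (fun t => ∫ s in unitBall d, data c q ((1 / 2 : ℝ) • (t - s)) * g s)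
      map_add' := by
        intro g h
        rw [← MemLp.toLp_add]
        refine MemLp.toLp_congr _ _ (Eventually.of_forall fun t => ?_)
        simp only [Pi.add_apply]
        rw [← integral_add (integrable_kernel c q g t) (integrable_kernel c q h t)]
        refine integral_congr_ae ?_
        filter_upwards [Lp.coeFn_add g h] with s hs
        rw [hs, Pi.add_apply, mul_add]
      map_smul' := by
        intro a g
        rw [RingHom.id_apply, ← MemLp.toLp_const_smul]
        refine MemLp.toLp_congr _ _ (Eventually.of_forall fun t => ?_)
        simp only [Pi.smul_apply]
        rw [← integral_smul]
        refine integral_congr_ae ?_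
        filter_upwards [Lp.coeFn_smul a g] with s hs
        rw [hs, Pi.smul_apply, smul_eq_mul, smul_eq_mul]
        ring }
    (by
      obtain ⟨K, hK, hg⟩ := exists_integral_norm_le d
      refine ⟨(measureUnivNNReal (volume.restrict (unitBall d)) : ℝ) ^
        ((2 : ENNReal).toReal)⁻¹ * ((∫ y in unitBall d, ‖(q y : ℂ)‖) * K), fun g => ?_⟩
      have hq : 0 ≤ ∫ y in unitBall d, ‖(q y : ℂ)‖ := integral_nonneg fun _ => norm_nonneg _
      rw [mul_assoc, mul_assoc]
      refine Lp.norm_le_of_ae_bound (by positivity) ?_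
      filter_upwards [MemLp.coeFn_toLp (memLp_kernel_integral c q g)] with t ht
      simp only [LinearMap.coe_mk, AddHom.coe_mk]
      rw [ht]
      exact (norm_kernel_integral_le c q g t).trans (mul_le_mul_of_nonneg_left (hg g) hq))

/-- The positive square root `T^{1/2}` of a positive bounded operator on a complex Hilbert space. -/
def opSqrt {H : Type*} [NormedAddCommGroup H] [InnerProductSpace ℂ H] [CompleteSpace H]
    (T : H →L[ℂ] H) : H →L[ℂ] H :=
  CFC.sqrt T

/-- `(μ_n, ζ_n)` is an eigensystem of the operator `N`: a complete orthonormal sequence of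
eigenvectors with positive eigenvalues listed in non-increasing order. -/
structure IsEigensystem {d : ℕ} (N : L2B d →L[ℂ] L2B d) (μ : ℕ → ℝ)
    (ζ : HilbertBasis ℕ ℂ (L2B d)) : Prop where
  apply_eq : ∀ n, N (ζ n) = (μ n : ℂ) • ζ n
  antitone : Antitone μ
  pos : ∀ n, 0 < μ n

/-- A regularizing filter `(f_α)_{α > 0}` on `(0, ∞)`. Only values at `α > 0`, `μ > 0` matter, and
no continuity of `f_α` is required. -/
structure IsRegularizingFilter (f : ℝ → ℝ → ℝ) : Prop where
  bounded : ∀ α, 0 < α → ∃ C : ℝ, ∀ μ, 0 < μ → |f α μ| ≤ C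
  tendsto : ∀ μ, 0 < μ → Tendsto (fun α => f α μ) (𝓝[>] 0) (𝓝 (1 / μ))
  uniform_bound : ∃ d₀ : ℝ, 0 < d₀ ∧ ∀ α, 0 < α → ∀ μ, 0 < μ → |μ * f α μ| ≤ d₀

/-- `R_α h = ∑ₙ f_α(μₙ²) μₙ ⟨h, ζₙ⟩ ζₙ`, for a single filter function `f = f_α`. -/
def regularize {d : ℕ} (μ : ℕ → ℝ) (ζ : HilbertBasis ℕ ℂ (L2B d)) (f : ℝ → ℝ) (h : L2B d) :
    L2B d :=
  ∑' n, (((f (μ n ^ 2) * μ n : ℝ) : ℂ) * inner ℂ (ζ n) h) • ζ n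

/-- The indicator `⟨g, N g⟩ = ∫_B g conj(N g)`. -/
def glsmIndicator {d : ℕ} (N : L2B d →L[ℂ] L2B d) (g : L2B d) : ℂ := inner ℂ (N g) g

end GLSM

end

noncomputable section

namespace GLSM

/-! ### Spectral theorem for injective positive compact operators -/

section Spectral

/-! Put `p = √q`, let `K` be the Fourier operator with kernel `exp(i c t·y)` restricted to the ball,
and `T = K M_p`. Splitting the exponential in `u((t - s)/2)` gives `N = T T*`
(`dataOperator_eq_factorOp_comp_adjoint`). So `N` is positive, and compact because `K` is. It is
injective because `T* g = p · K* g`, `p > 0` on the open set `Ω`, and a Fourier transform of a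
function on the ball is analytic, so it cannot vanish on an open set unless the function is zero.
The spectral theorem then supplies the eigensystem.

In the eigenbasis the indicator is the series of `(μₙ² f_α(μₙ²))² |⟨φ, ζₙ⟩|² / μₙ`. The first factor
is bounded uniformly and tends to `1`, so everything depends on the Picard series `∑ |⟨φ, ζₙ⟩|² /
μₙ`. If it converges, dominated convergence gives the limit, which is the squared norm of the
solution of `N^{1/2} g = φ`. If it diverges, finite partial sums already push the indicator to
infinity.

By Picard's criterion (`mem_range_iff_summable`) convergence means `φ ∈ range T`. Here `φ = K E`
with `E = 1_R / |R|`. If `R ⊆ Ω`, then `φ = T (E / p)`. If `R` leaves the closure of `Ω`, then `φ =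
T w` would force `p w = E` by injectivity of `K`, while `p = 0` and `E > 0` on a nonempty open set.
-/

theorem exists_antitone_enumeration {ι : Type*} [Infinite ι] (m : ι → ℝ) (hpos : ∀ i, 0 < m i)
    (hfin : ∀ ε, 0 < ε → {i | ε ≤ m i}.Finite) : ∃ e : ℕ ≃ ι, Antitone (m ∘ e) := by
  classical
  -- Greedy choice: only finitely many indices reach the value at `i₀`, so a maximum over the
  -- complement of `s` exists.
  have step : ∀ s : Finset ι, ∃ i, i ∉ s ∧ ∀ j, j ∉ s → m j ≤ m i := by
    intro s
    obtain ⟨i₀, hi₀⟩ := Infinite.exists_notMem_finset s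
    have hf : ({i | m i₀ ≤ m i} \ (s : Set ι)).Finite := (hfin _ (hpos i₀)).sdiff
    obtain ⟨i, ⟨hi, his⟩, hmax⟩ := Set.exists_max_image _ m hf ⟨i₀, le_refl (m i₀), by simpa using hi₀⟩
    refine ⟨i, by simpa using his, fun j hj => ?_⟩
    rcases le_total (m i₀) (m j) with h | h
    · exact hmax j ⟨h, by simpa using hj⟩
    · exact h.trans hi
  choose nxt hnxt hmax using step
  let S : ℕ → Finset ι := fun n => Nat.rec ∅ (fun _ s => insert (nxt s) s) n
  have hS : ∀ n, S (n + 1) = insert (nxt (S n)) (S n) := fun n => rfl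
  have hSm : Monotone S := monotone_nat_of_le_succ fun n => by
    rw [hS]; exact Finset.subset_insert _ _
  have hlt : ∀ {a b}, a < b → nxt (S a) ∈ S b := fun {a b} h =>
    hSm (Nat.succ_le_of_lt h) (by rw [Nat.succ_eq_add_one, hS]; exact Finset.mem_insert_self _ _)
  have hinj : Function.Injective fun n => nxt (S n) := by
    intro a b h
    rcases lt_trichotomy a b with hab | hab | hab
    · exact absurd (hlt hab) (by simp only at h; rw [h]; exact hnxt _)
    · exact hab
    · exact absurd (hlt hab) (by simp only at h; rw [← h]; exact hnxt _)
  have hmem : ∀ n, ∀ j ∈ S n, j ∈ range fun n => nxt (S n) := by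
    intro n
    induction n with
    | zero => intro j hj; simp [S] at hj
    | succ n ih =>
      intro j hj
      rw [hS, Finset.mem_insert] at hj
      rcases hj with rfl | hj
      · exact ⟨n, rfl⟩
      · exact ih j hj
  have hsurj : Function.Surjective fun n => nxt (S n) := by
    intro j
    by_contra hj
    -- An index never chosen stays available at every stage, so infinitely many chosen indices would
    -- have values at least `m j`.
    have h2 : ∀ n, m j ≤ m (nxt (S n)) := fun n => hmax _ _ fun h => hj (hmem n j h)
    exact (Set.infinite_range_of_injective hinj)
      ((hfin _ (hpos j)).subset (by rintro _ ⟨n, rfl⟩; exact h2 n))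
  refine ⟨Equiv.ofBijective _ ⟨hinj, hsurj⟩, antitone_nat_of_succ_le fun n => ?_⟩
  exact hmax _ _ fun h => hnxt (S (n + 1)) (hSm n.le_succ h)

variable {H : Type*} [NormedAddCommGroup H] [InnerProductSpace ℂ H]

/-- Images of distinct orthonormal eigenvectors with eigenvalues at least `ε` are at distance at
least `ε`, so infinitely many of them would have no convergent subsequence. -/
theorem finite_setOf_le_eigenvalue {N : H →L[ℂ] H} (hN : IsCompactOperator N) {ι : Type*}
    {v : ι → H} (hv : Orthonormal ℂ v) {m : ι → ℝ} (hm : ∀ i, N (v i) = (m i : ℂ) • v i)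
    {ε : ℝ} (hε : 0 < ε) : {i | ε ≤ m i}.Finite := by
  by_contra hinf
  let e := Set.Infinite.natEmbedding _ hinf
  have hc := hN.isCompact_closure_image_closedBall 1
  have hmem : ∀ k, N (v (e k)) ∈ closure (N '' Metric.closedBall 0 1) := fun k =>
    subset_closure ⟨_, by simp [hv.1], rfl⟩
  obtain ⟨a, -, φ, hφ, hlim⟩ := hc.tendsto_subseq hmem
  obtain ⟨K, hK⟩ := Metric.cauchySeq_iff.1 hlim.cauchySeq ε hε
  have h1 := hK K le_rfl (K + 1) (Nat.le_succ K)
  have hne : ((e (φ K) : {i | ε ≤ m i}) : ι) ≠ e (φ (K + 1)) := fun h =>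
    (hφ (Nat.lt_succ_self K)).ne (e.injective (Subtype.ext h))
  have h2 : inner ℂ (v (e (φ K))) (N (v (e (φ K))) - N (v (e (φ (K + 1))))) = (m (e (φ K)) : ℂ) := by
    rw [inner_sub_right, hm, hm, inner_smul_right, inner_smul_right, hv.2 hne,
      inner_self_eq_norm_sq_to_K, hv.1]
    simp
  have h3 := norm_inner_le_norm (𝕜 := ℂ) (v (e (φ K))) (N (v (e (φ K))) - N (v (e (φ (K + 1)))))
  rw [h2, hv.1, one_mul, Complex.norm_real, Real.norm_eq_abs] at h3
  rw [dist_eq_norm] at h1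
  exact absurd (((e (φ K)).2 : ε ≤ m (e (φ K))).trans ((le_abs_self _).trans h3)) (not_le.2 h1)

open scoped ComplexOrder in
theorem exists_eigensystem [CompleteSpace H] {N : H →L[ℂ] H} (hN : IsCompactOperator N)
    (hpos : N.IsPositive) (hinj : Function.Injective N) (hinf : ¬ FiniteDimensional ℂ H) :
    ∃ (μ : ℕ → ℝ) (ζ : HilbertBasis ℕ ℂ H),
      (∀ n, N (ζ n) = (μ n : ℂ) • ζ n) ∧ Antitone μ ∧ ∀ n, 0 < μ n := by
  have hsymm : (N : H →ₗ[ℂ] H).IsSymmetric := hpos.isSymmetric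
  let V : ℂ → Submodule ℂ H := fun μ => Module.End.eigenspace (N : Module.End ℂ H) μ
  have hfd : ∀ μ, FiniteDimensional ℂ (V μ) := by
    intro μ
    rcases eq_or_ne μ 0 with rfl | h
    · have : V 0 = ⊥ := by
        simp only [V, Module.End.eigenspace_zero]
        exact LinearMap.ker_eq_bot.2 hinj
      rw [this]; infer_instance
    · exact N.finite_dimensional_eigenspace hN μ h
  let b : ∀ μ, OrthonormalBasis (Fin (Module.finrank ℂ (V μ))) ℂ (V μ) :=
    fun μ => stdOrthonormalBasis ℂ (V μ)
  -- The sum runs over all complex numbers; those that are not eigenvalues contribute an empty `Fin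
  -- 0`. Injectivity has excluded the zero eigenspace, which could have been infinite dimensional.
  let ι := Σ μ : ℂ, Fin (Module.finrank ℂ (V μ))
  let v : ι → H := fun a => (b a.1 a.2 : H)
  have hv : Orthonormal ℂ v :=
    hsymm.orthogonalFamily_eigenspaces.orthonormal_sigma_orthonormal fun μ => (b μ).orthonormal
  have hNv : ∀ a, N (v a) = a.1 • v a := fun a =>
    Module.End.mem_eigenspace_iff.1 (b a.1 a.2).2
  have hsp : (Submodule.span ℂ (range v))ᗮ = ⊥ := by
    rw [eq_bot_iff, ← ContinuousLinearMap.orthogonalComplement_iSup_eigenspaces_eq_bot hN hsymm]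
    refine Submodule.orthogonal_le (iSup_le fun μ => ?_)
    intro x hx
    have h1 := (b μ).sum_repr ⟨x, hx⟩
    have h2 : ∑ i, (b μ).repr ⟨x, hx⟩ i • (v ⟨μ, i⟩) = x := by
      simpa [v] using congrArg Subtype.val h1
    rw [← h2]
    exact Submodule.sum_mem _ fun i _ => Submodule.smul_mem _ _ (Submodule.subset_span ⟨_, rfl⟩)
  have hcpos : ∀ a : ι, 0 < a.1 := by
    intro a
    have h1 := hpos.inner_nonneg_right (v a)
    rw [hNv, inner_smul_right, inner_self_eq_norm_sq_to_K, hv.1] at h1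
    refine lt_of_le_of_ne (by simpa using h1) fun h0 => ?_
    have h2 : N (v a) = N 0 := by rw [hNv, ← h0, zero_smul, map_zero]
    exact hv.ne_zero a (hinj h2)
  let m : ι → ℝ := fun a => a.1.re
  have hm : ∀ a, N (v a) = (m a : ℂ) • v a := by
    intro a
    rw [hNv, ← (Complex.eq_re_of_ofReal_le (hcpos a).le : a.1 = _)]
  have hmpos : ∀ a, 0 < m a := fun a => (Complex.pos_iff.1 (hcpos a)).1
  let B : HilbertBasis ι ℂ H := HilbertBasis.mkOfOrthogonalEqBot hv hsp
  have : Infinite ι := by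
    by_contra h
    have := not_infinite_iff_finite.1 h
    have := Fintype.ofFinite ι
    exact hinf B.toOrthonormalBasis.toBasis.finiteDimensional_of_finite
  obtain ⟨e, he⟩ := exists_antitone_enumeration m hmpos
    fun ε hε => finite_setOf_le_eigenvalue hN hv hm hε
  have hve : Orthonormal ℂ (v ∘ e) := hv.comp _ e.injective
  refine ⟨m ∘ e, HilbertBasis.mkOfOrthogonalEqBot hve ?_, fun n => ?_, he, fun n => hmpos _⟩
  · rw [EquivLike.range_comp]; exact hsp
  · simpa using hm (e n)

end Spectral

/-! ### Diagonal form of the operator, its square root, and Picard's criterion -/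

section Diagonal

variable {H : Type*} [NormedAddCommGroup H] [InnerProductSpace ℂ H]
  {N : H →L[ℂ] H} {μ : ℕ → ℝ} {ζ : HilbertBasis ℕ ℂ H}

theorem hasSum_norm_inner_sq (ζ : HilbertBasis ℕ ℂ H) (g : H) :
    HasSum (fun n => ‖inner ℂ (ζ n) g‖ ^ 2) (‖g‖ ^ 2) := by
  have h := ζ.hasSum_inner_mul_inner g g
  rw [inner_self_eq_norm_sq_to_K] at h
  rw [← Complex.hasSum_ofReal]
  have h1 : (fun n => ((‖inner ℂ (ζ n) g‖ ^ 2 : ℝ) : ℂ)) =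
      fun n => inner ℂ g (ζ n) * inner ℂ (ζ n) g := funext fun n => by
    rw [← inner_conj_symm g, RCLike.conj_mul]; simp
  rw [h1]
  simpa using h

theorem exists_inner_eq (ζ : HilbertBasis ℕ ℂ H) {a : ℕ → ℂ} (ha : Summable fun n => ‖a n‖ ^ 2) :
    ∃ g : H, ∀ n, inner ℂ (ζ n) g = a n := by
  have hmem : Memℓp a 2 := by
    refine memℓp_gen ?_
    simpa using ha
  refine ⟨ζ.repr.symm ⟨a, hmem⟩, fun n => ?_⟩
  rw [← ζ.repr_apply_apply, LinearIsometryEquiv.apply_symm_apply]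

theorem ext_inner_basis (ζ : HilbertBasis ℕ ℂ H) {g h : H}
    (H : ∀ n, inner ℂ (ζ n) g = inner ℂ (ζ n) h) : g = h := by
  apply ζ.repr.injective
  ext n
  rw [ζ.repr_apply_apply, ζ.repr_apply_apply, H]

theorem inner_basis_apply (hs : (N : H →ₗ[ℂ] H).IsSymmetric)
    (hN : ∀ n, N (ζ n) = (μ n : ℂ) • ζ n) (g : H) (n : ℕ) :
    inner ℂ (ζ n) (N g) = μ n * inner ℂ (ζ n) g := by
  have h := hs (ζ n) g
  simp only [ContinuousLinearMap.coe_coe] at h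
  rw [← h, hN, inner_smul_left, Complex.conj_ofReal]

theorem hasSum_inner_apply_self (hs : (N : H →ₗ[ℂ] H).IsSymmetric)
    (hN : ∀ n, N (ζ n) = (μ n : ℂ) • ζ n) (g : H) :
    HasSum (fun n => ((μ n * ‖inner ℂ (ζ n) g‖ ^ 2 : ℝ) : ℂ)) (inner ℂ (N g) g) := by
  have h1 : (fun n => ((μ n * ‖inner ℂ (ζ n) g‖ ^ 2 : ℝ) : ℂ)) =
      fun n => inner ℂ (N g) (ζ n) * inner ℂ (ζ n) g := funext fun n => by
    rw [← inner_conj_symm (N g), inner_basis_apply hs hN, map_mul, Complex.conj_ofReal, mul_assoc,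
      RCLike.conj_mul]
    simp
  rw [h1]
  exact ζ.hasSum_inner_mul_inner (N g) g

open scoped ComplexOrder in
-- With `S = √N`, the factorization `(S + √m)(S - √m) v = 0` makes `w = S v - √m v` satisfy `S w =
-- -√m w`. Positivity of `S` then leaves only `w = 0`.
theorem sqrt_apply_eigenvector [CompleteSpace H] (hpos : N.IsPositive) {m : ℝ} (hm : 0 < m) {v : H}
    (hv : N v = (m : ℂ) • v) : opSqrt N v = (Real.sqrt m : ℂ) • v := by
  have h0 : 0 ≤ N := (ContinuousLinearMap.nonneg_iff_isPositive N).2 hpos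
  have hS : (opSqrt N).IsPositive :=
    (ContinuousLinearMap.nonneg_iff_isPositive _).1 (CFC.sqrt_nonneg N)
  have hSS : ∀ x, opSqrt N (opSqrt N x) = N x := fun x =>
    DFunLike.congr_fun (CFC.sqrt_mul_sqrt_self N h0) x
  set w := opSqrt N v - (Real.sqrt m : ℂ) • v with hw
  have hmm : (Real.sqrt m : ℂ) * Real.sqrt m = m := by
    rw [← Complex.ofReal_mul, Real.mul_self_sqrt hm.le]
  have h1 : opSqrt N w = -(Real.sqrt m : ℂ) • w := by
    rw [hw, map_sub, hSS, hv, map_smul, smul_sub, smul_smul, ← hmm]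
    simp only [neg_smul, neg_mul]
    abel
  have h2 := hS.inner_nonneg_right w
  rw [h1, inner_smul_right, inner_self_eq_norm_sq_to_K] at h2
  have h3 : 0 ≤ -(Real.sqrt m) * ‖w‖ ^ 2 := by
    have := (Complex.le_def.1 h2).1
    simpa [← Complex.ofReal_pow] using this
  have h4 : ‖w‖ ^ 2 ≤ 0 := by
    have := Real.sqrt_pos.2 hm
    nlinarith
  have h5 : w = 0 := by
    rw [← norm_eq_zero]; exact pow_eq_zero_iff two_ne_zero |>.1 (le_antisymm h4 (sq_nonneg _))
  exact sub_eq_zero.1 h5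

theorem sqrt_apply_eq_iff [CompleteSpace H] (hpos : N.IsPositive)
    (hN : ∀ n, N (ζ n) = (μ n : ℂ) • ζ n) (hμ : ∀ n, 0 < μ n) (g h : H) :
    opSqrt N g = h ↔ ∀ n, inner ℂ (ζ n) g = inner ℂ (ζ n) h / Real.sqrt (μ n) := by
  have hS : (opSqrt N).IsPositive :=
    (ContinuousLinearMap.nonneg_iff_isPositive _).1 (CFC.sqrt_nonneg N)
  have key := inner_basis_apply (ζ := ζ) hS.isSymmetric
    (fun n => sqrt_apply_eigenvector hpos (hμ n) (hN n))
  have hne : ∀ n, (Real.sqrt (μ n) : ℂ) ≠ 0 := fun n =>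
    Complex.ofReal_ne_zero.2 (Real.sqrt_pos.2 (hμ n)).ne'
  constructor
  · rintro rfl n
    rw [key, mul_div_cancel_left₀ _ (hne n)]
  · intro H
    refine ext_inner_basis ζ fun n => ?_
    rw [key, H, mul_div_cancel₀ _ (hne n)]

variable {F : Type*} [NormedAddCommGroup F] [InnerProductSpace ℂ F] [CompleteSpace F]
  [CompleteSpace H]

/-- Picard's criterion. -/
theorem mem_range_iff_summable {T : F →L[ℂ] H} (hNT : N = T ∘L T.adjoint)
    (hN : ∀ n, N (ζ n) = (μ n : ℂ) • ζ n) (hμ : ∀ n, 0 < μ n) (h : H) :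
    h ∈ range T ↔ Summable fun n => ‖inner ℂ (ζ n) h‖ ^ 2 / μ n := by
  have hsq : ∀ n, (Real.sqrt (μ n) : ℂ) * Real.sqrt (μ n) = μ n := fun n => by
    rw [← Complex.ofReal_mul, Real.mul_self_sqrt (hμ n).le]
  have hne : ∀ n, (Real.sqrt (μ n) : ℂ) ≠ 0 := fun n =>
    Complex.ofReal_ne_zero.2 (Real.sqrt_pos.2 (hμ n)).ne'
  -- Right singular vectors of `T`. They need not be complete: Bessel's inequality suffices for one
  -- direction, and `T e_n = √μ_n ζ_n` for the other.
  let e : ℕ → F := fun n => ((Real.sqrt (μ n) : ℂ)⁻¹) • T.adjoint (ζ n)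
  have hin : ∀ n m, inner ℂ (T.adjoint (ζ n)) (T.adjoint (ζ m)) =
      (μ m : ℂ) * inner ℂ (ζ n) (ζ m) := by
    intro n m
    rw [ContinuousLinearMap.adjoint_inner_left, ← inner_smul_right, ← hN m, hNT]
    rfl
  have he : Orthonormal ℂ e := by
    rw [orthonormal_iff_ite]
    intro n m
    simp only [e]
    rw [inner_smul_left, inner_smul_right, hin, orthonormal_iff_ite.1 ζ.orthonormal, map_inv₀,
      Complex.conj_ofReal]
    split_ifs with hnm
    · subst hnm
      rw [← hsq n]
      field_simp [hne n]
    · simp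
  have hn : ∀ n, ‖(Real.sqrt (μ n) : ℂ)⁻¹‖ ^ 2 = (μ n)⁻¹ := fun n => by
    rw [norm_inv, Complex.norm_real, inv_pow, Real.norm_eq_abs, sq_abs, Real.sq_sqrt (hμ n).le]
  constructor
  · rintro ⟨w, rfl⟩
    refine (he.inner_products_summable w).congr fun n => ?_
    simp only [e]
    rw [inner_smul_left, norm_mul, mul_pow, RCLike.norm_conj, hn,
      ContinuousLinearMap.adjoint_inner_left, div_eq_inv_mul]
  · intro hs
    let a : ℕ → ℂ := fun n => (Real.sqrt (μ n) : ℂ)⁻¹ * inner ℂ (ζ n) h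
    have hmem : Memℓp a 2 := by
      refine memℓp_gen ?_
      refine hs.congr fun n => ?_
      simp only [a]
      rw [norm_mul, ENNReal.toReal_ofNat, Real.rpow_ofNat, mul_pow, hn, div_eq_inv_mul]
    have hsum := he.orthogonalFamily.hasSum_linearIsometry ⟨a, hmem⟩
    refine ⟨_, HasSum.unique (hsum.mapL T) ?_⟩
    convert ζ.hasSum_repr h using 2 with n
    have hT : T (T.adjoint (ζ n)) = (μ n : ℂ) • ζ n := by rw [← hN, hNT]; rfl
    simp only [LinearIsometry.toSpanSingleton_apply, a, e, map_smul, hT, smul_smul,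
      ζ.repr_apply_apply]
    congr 1
    rw [← hsq n]
    field_simp [hne n]

end Diagonal

/-! ### The indicator as a filtered Picard series -/

section Filter

variable {d : ℕ} {N : L2B d →L[ℂ] L2B d} {μ : ℕ → ℝ} {ζ : HilbertBasis ℕ ℂ (L2B d)}

/-- Boundedness of `f` and `μ n ≤ μ 0` make the coefficients square summable, so the `tsum` in
`regularize` converges and is not the default value `0`. -/
theorem inner_regularize (hE : IsEigensystem N μ ζ) {f : ℝ → ℝ} {C : ℝ}
    (hf : ∀ x, 0 < x → |f x| ≤ C) (h : L2B d) (n : ℕ) :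
    inner ℂ (ζ n) (regularize μ ζ f h) = ((f (μ n ^ 2) * μ n : ℝ) : ℂ) * inner ℂ (ζ n) h := by
  have hb : ∀ n, |f (μ n ^ 2) * μ n| ≤ C * μ 0 := fun n => by
    rw [abs_mul, abs_of_pos (hE.pos n)]
    have h1 := hf _ (pow_pos (hE.pos n) 2)
    exact mul_le_mul h1 (hE.antitone (Nat.zero_le n)) (hE.pos n).le ((abs_nonneg _).trans h1)
  have hs : Summable fun n => ‖((f (μ n ^ 2) * μ n : ℝ) : ℂ) * inner ℂ (ζ n) h‖ ^ 2 := by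
    refine Summable.of_nonneg_of_le (fun n => sq_nonneg _) (fun n => ?_)
      ((hasSum_norm_inner_sq ζ h).summable.mul_left ((C * μ 0) ^ 2))
    rw [norm_mul, mul_pow, Complex.norm_real, Real.norm_eq_abs]
    exact mul_le_mul_of_nonneg_right (pow_le_pow_left₀ (abs_nonneg _) (hb n) 2) (sq_nonneg _)
  obtain ⟨g, hg⟩ := exists_inner_eq ζ hs
  have : regularize μ ζ f h = g := by
    refine HasSum.tsum_eq ?_
    convert ζ.hasSum_repr g using 3 with n
    rw [ζ.repr_apply_apply, hg]
  rw [this, hg]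

/-- The weight `f² μ³` is regrouped as `(μ² f)² / μ`, which separates the Picard term from the
factor controlled by the filter axioms. -/
theorem hasSum_glsmIndicator (hs : (N : L2B d →ₗ[ℂ] L2B d).IsSymmetric) (hE : IsEigensystem N μ ζ)
    {f : ℝ → ℝ} {C : ℝ} (hf : ∀ x, 0 < x → |f x| ≤ C) (h : L2B d) :
    HasSum (fun n => (((μ n ^ 2 * f (μ n ^ 2)) ^ 2 * (‖inner ℂ (ζ n) h‖ ^ 2 / μ n) : ℝ) : ℂ))
      (glsmIndicator N (regularize μ ζ f h)) := by
  have h1 := hasSum_inner_apply_self hs hE.apply_eq (regularize μ ζ f h)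
  have h2 : (fun n => (((μ n ^ 2 * f (μ n ^ 2)) ^ 2 * (‖inner ℂ (ζ n) h‖ ^ 2 / μ n) : ℝ) : ℂ)) =
      fun n => ((μ n * ‖inner ℂ (ζ n) (regularize μ ζ f h)‖ ^ 2 : ℝ) : ℂ) := funext fun n => by
    rw [inner_regularize hE hf, norm_mul, Complex.norm_real, mul_pow ‖_‖, Real.norm_eq_abs, sq_abs]
    have := (hE.pos n).ne'
    congr 1
    field_simp
  rw [h2]
  exact h1

theorem glsmIndicator_eq_tsum (hs : (N : L2B d →ₗ[ℂ] L2B d).IsSymmetric)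
    (hE : IsEigensystem N μ ζ) {f : ℝ → ℝ} {C : ℝ} (hf : ∀ x, 0 < x → |f x| ≤ C) (h : L2B d) :
    glsmIndicator N (regularize μ ζ f h) =
      ((∑' n, (μ n ^ 2 * f (μ n ^ 2)) ^ 2 * (‖inner ℂ (ζ n) h‖ ^ 2 / μ n) : ℝ) : ℂ) := by
  rw [← (hasSum_glsmIndicator hs hE hf h).tsum_eq, Complex.ofReal_tsum]

theorem summable_glsmIndicator (hs : (N : L2B d →ₗ[ℂ] L2B d).IsSymmetric)
    (hE : IsEigensystem N μ ζ) {f : ℝ → ℝ} {C : ℝ} (hf : ∀ x, 0 < x → |f x| ≤ C) (h : L2B d) :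
    Summable fun n => (μ n ^ 2 * f (μ n ^ 2)) ^ 2 * (‖inner ℂ (ζ n) h‖ ^ 2 / μ n) :=
  Complex.summable_ofReal.1 (hasSum_glsmIndicator hs hE hf h).summable

theorem IsRegularizingFilter.tendsto_coeff {f : ℝ → ℝ → ℝ} (hf : IsRegularizingFilter f) {m : ℝ}
    (hm : 0 < m) (x : ℝ) :
    Tendsto (fun α => (m ^ 2 * f α (m ^ 2)) ^ 2 * x) (𝓝[>] 0) (𝓝 x) := by
  have h1 := (((hf.tendsto (m ^ 2) (pow_pos hm 2)).const_mul (m ^ 2)).pow 2).mul_const x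
  have h2 : (m ^ 2 * (1 / m ^ 2)) ^ 2 * x = x := by
    have := hm.ne'
    field_simp
  rwa [h2] at h1

theorem glsmIndicator_bounded_tendsto (hs : (N : L2B d →ₗ[ℂ] L2B d).IsSymmetric)
    (hE : IsEigensystem N μ ζ) {f : ℝ → ℝ → ℝ} (hf : IsRegularizingFilter f) {h : L2B d}
    (hsum : Summable fun n => ‖inner ℂ (ζ n) h‖ ^ 2 / μ n) :
    (∃ C : ℝ, ∀ α, 0 < α → ‖glsmIndicator N (regularize μ ζ (f α) h)‖ ≤ C) ∧
    Tendsto (fun α => glsmIndicator N (regularize μ ζ (f α) h)) (𝓝[>] 0)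
      (𝓝 ((∑' n, ‖inner ℂ (ζ n) h‖ ^ 2 / μ n : ℝ) : ℂ)) := by
  obtain ⟨D, hD, hfD⟩ := hf.uniform_bound
  have hnn : ∀ n, 0 ≤ ‖inner ℂ (ζ n) h‖ ^ 2 / μ n := fun n =>
    div_nonneg (sq_nonneg _) (hE.pos n).le
  have hle : ∀ α, 0 < α → ∀ n, (μ n ^ 2 * f α (μ n ^ 2)) ^ 2 * (‖inner ℂ (ζ n) h‖ ^ 2 / μ n) ≤
      D ^ 2 * (‖inner ℂ (ζ n) h‖ ^ 2 / μ n) := fun α hα n => by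
    refine mul_le_mul_of_nonneg_right ?_ (hnn n)
    rw [← sq_abs]
    exact pow_le_pow_left₀ (abs_nonneg _) (hfD α hα _ (pow_pos (hE.pos n) 2)) 2
  have heq : ∀ α, 0 < α → glsmIndicator N (regularize μ ζ (f α) h) =
      ((∑' n, (μ n ^ 2 * f α (μ n ^ 2)) ^ 2 * (‖inner ℂ (ζ n) h‖ ^ 2 / μ n) : ℝ) : ℂ) :=
    fun α hα => by
      obtain ⟨C, hC⟩ := hf.bounded α hα
      exact glsmIndicator_eq_tsum hs hE hC h
  constructor
  · refine ⟨∑' n, D ^ 2 * (‖inner ℂ (ζ n) h‖ ^ 2 / μ n), fun α hα => ?_⟩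
    obtain ⟨C, hC⟩ := hf.bounded α hα
    rw [heq α hα, Complex.norm_real, Real.norm_eq_abs,
      abs_of_nonneg (tsum_nonneg fun n => mul_nonneg (sq_nonneg _) (hnn n))]
    exact (summable_glsmIndicator hs hE hC h).tsum_le_tsum (hle α hα) (hsum.mul_left _)
  · have h1 : Tendsto (fun α => ∑' n, (μ n ^ 2 * f α (μ n ^ 2)) ^ 2 *
        (‖inner ℂ (ζ n) h‖ ^ 2 / μ n)) (𝓝[>] 0) (𝓝 (∑' n, ‖inner ℂ (ζ n) h‖ ^ 2 / μ n)) := by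
      refine tendsto_tsum_of_dominated_convergence (hsum.mul_left (D ^ 2))
        (fun n => hf.tendsto_coeff (hE.pos n) _) ?_
      filter_upwards [self_mem_nhdsWithin] with α hα n
      rw [Real.norm_eq_abs, abs_of_nonneg (mul_nonneg (sq_nonneg _) (hnn n))]
      exact hle α hα n
    refine ((Complex.continuous_ofReal.tendsto _).comp h1).congr' ?_
    filter_upwards [self_mem_nhdsWithin] with α hα
    exact (heq α hα).symm

theorem glsmIndicator_real_tendsto_atTop (hs : (N : L2B d →ₗ[ℂ] L2B d).IsSymmetric)
    (hE : IsEigensystem N μ ζ) {f : ℝ → ℝ → ℝ} (hf : IsRegularizingFilter f) {h : L2B d}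
    (hsum : ¬ Summable fun n => ‖inner ℂ (ζ n) h‖ ^ 2 / μ n) :
    (∀ α, 0 < α → (glsmIndicator N (regularize μ ζ (f α) h)).im = 0) ∧
    Tendsto (fun α => (glsmIndicator N (regularize μ ζ (f α) h)).re) (𝓝[>] 0) atTop := by
  have hnn : ∀ n, 0 ≤ ‖inner ℂ (ζ n) h‖ ^ 2 / μ n := fun n =>
    div_nonneg (sq_nonneg _) (hE.pos n).le
  constructor
  · intro α hα
    obtain ⟨C, hC⟩ := hf.bounded α hα
    rw [glsmIndicator_eq_tsum hs hE hC h, Complex.ofReal_im]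
  · refine tendsto_atTop.2 fun M => ?_
    -- A finite partial sum of the divergent series exceeds `M`; its filtered version does so for
    -- small `α`, and the remaining terms are nonnegative.
    obtain ⟨K, hK⟩ := ((not_summable_iff_tendsto_nat_atTop_of_nonneg hnn).1 hsum
      |>.eventually_gt_atTop M).exists
    have h1 : Tendsto (fun α => ∑ n ∈ Finset.range K, (μ n ^ 2 * f α (μ n ^ 2)) ^ 2 *
        (‖inner ℂ (ζ n) h‖ ^ 2 / μ n)) (𝓝[>] 0)
        (𝓝 (∑ n ∈ Finset.range K, ‖inner ℂ (ζ n) h‖ ^ 2 / μ n)) :=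
      tendsto_finsetSum _ fun n _ => hf.tendsto_coeff (hE.pos n) _
    filter_upwards [self_mem_nhdsWithin, h1.eventually (lt_mem_nhds hK)] with α hα hlt
    obtain ⟨C, hC⟩ := hf.bounded α hα
    rw [glsmIndicator_eq_tsum hs hE hC h, Complex.ofReal_re]
    exact hlt.le.trans ((summable_glsmIndicator hs hE hC h).sum_le_tsum _
      fun n _ => mul_nonneg (sq_nonneg _) (hnn n))

theorem exists_unique_sqrt_preimage (hpos : N.IsPositive) (hE : IsEigensystem N μ ζ) {h : L2B d}
    (hsum : Summable fun n => ‖inner ℂ (ζ n) h‖ ^ 2 / μ n) :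
    ∃ g, (∀ g', opSqrt N g' = h ↔ g' = g) ∧ ‖g‖ ^ 2 = ∑' n, ‖inner ℂ (ζ n) h‖ ^ 2 / μ n := by
  have hn : ∀ n, ‖inner ℂ (ζ n) h / (Real.sqrt (μ n) : ℂ)‖ ^ 2 = ‖inner ℂ (ζ n) h‖ ^ 2 / μ n :=
    fun n => by
      rw [norm_div, div_pow, Complex.norm_real, Real.norm_eq_abs, sq_abs,
        Real.sq_sqrt (hE.pos n).le]
  obtain ⟨g, hg⟩ := exists_inner_eq ζ (a := fun n => inner ℂ (ζ n) h / (Real.sqrt (μ n) : ℂ))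
    (by simpa only [hn] using hsum)
  refine ⟨g, fun g' => ?_, ?_⟩
  · rw [sqrt_apply_eq_iff hpos hE.apply_eq hE.pos]
    refine ⟨fun H => ext_inner_basis ζ fun n => by rw [H, hg], ?_⟩
    rintro rfl
    exact hg
  · rw [← (hasSum_norm_inner_sq ζ g).tsum_eq]
    simp only [hg, hn]

end Filter

/-! ### Injectivity and analytic continuation of the exponential transform -/

section Fourier

variable {d : ℕ}

open scoped FourierTransform SchwartzMap in
-- After rescaling the frequency, `𝓕 h = 0`. Any test function is `g = 𝓕 ψ` with `ψ` Schwartz, and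
-- moving the transform onto `h` gives `∫ g h = ∫ ψ 𝓕 h = 0`.
theorem ae_eq_zero_of_expTransform_eq_zero {c : ℝ} (hc : c ≠ 0)
    {h : EuclideanSpace ℝ (Fin d) → ℂ} (hh : Integrable h)
    (h0 : ∀ x : EuclideanSpace ℝ (Fin d),
      ∫ y, Complex.exp (Complex.I * ((c * inner ℝ x y : ℝ) : ℂ)) * h y = 0) :
    h =ᵐ[volume] 0 := by
  have hF : ∀ w, 𝓕 h w = 0 := by
    intro w
    rw [Real.fourier_eq', ← h0 ((-2 * Real.pi / c) • w)]
    refine integral_congr_ae (Eventually.of_forall fun y => ?_)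
    simp only [smul_eq_mul]
    rw [inner_smul_left, real_inner_comm w y]
    congr 2
    rw [mul_comm]
    congr 2
    simp only [conj_trivial]
    field_simp
  refine ae_eq_zero_of_integral_contDiff_smul_eq_zero hh.locallyIntegrable fun g hg hgs => ?_
  have hgc : ContDiff ℝ (⊤ : ℕ∞) fun x => (g x : ℂ) := Complex.ofRealCLM.contDiff.comp hg
  have hgcs : HasCompactSupport fun x => (g x : ℂ) := hgs.comp_left Complex.ofReal_zero
  let G : 𝓢(EuclideanSpace ℝ (Fin d), ℂ) := hgcs.toSchwartzMap hgc
  have hG : ∀ x, G x = g x := fun x => rfl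
  let ψ : 𝓢(EuclideanSpace ℝ (Fin d), ℂ) := 𝓕⁻ G
  have hψ : 𝓕 ψ = G := FourierTransform.fourier_fourierInv_eq G
  have key := VectorFourier.integral_fourierIntegral_smul_eq_flip (L := innerₗ _)
    (μ := volume) (ν := volume) (f := ⇑ψ) (g := h) Real.continuous_fourierChar continuous_inner
    ψ.integrable hh
  have h1 : ∀ x, VectorFourier.fourierIntegral 𝐞 volume (innerₗ _) (⇑ψ) x = (g x : ℂ) := by
    intro x
    rw [← hG, ← hψ, SchwartzMap.fourier_coe]
    rfl
  have h2 : ∀ x, VectorFourier.fourierIntegral 𝐞 volume (innerₗ (EuclideanSpace ℝ (Fin d))).flip h x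
      = 0 := by
    intro x
    rw [flip_innerₗ]
    exact hF x
  simp only [h1, h2, smul_zero, integral_zero] at key
  simpa using key

theorem integrable_exp_mul (a : ℝ) (ν : Measure (EuclideanSpace ℝ (Fin d)))
    {h : EuclideanSpace ℝ (Fin d) → ℂ} (hh : Integrable h ν) (x : EuclideanSpace ℝ (Fin d)) :
    Integrable (fun y => Complex.exp (Complex.I * ((a * inner ℝ x y : ℝ) : ℂ)) * h y) ν :=
  hh.bdd_mul (c := 1) (Continuous.aestronglyMeasurable (by fun_prop))
    (Eventually.of_forall fun y => (norm_expI _).le)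

/-- An exponential integral with bounded domain extends to an entire function along every line. -/
theorem differentiable_expTransform_line (ν : Measure (EuclideanSpace ℝ (Fin d))) {r : ℝ}
    (hν : ∀ᵐ y ∂ν, ‖y‖ ≤ r) (c : ℝ) {h : EuclideanSpace ℝ (Fin d) → ℂ} (hh : Integrable h ν)
    (x v : EuclideanSpace ℝ (Fin d)) :
    Differentiable ℂ fun s : ℂ => ∫ y, Complex.exp (Complex.I *
      (((c * inner ℝ x y : ℝ) : ℂ) + s * ((c * inner ℝ v y : ℝ) : ℂ))) * h y ∂ν := by
  intro s₀
  set M := |c| * (‖v‖ * r) with hM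
  have hb : ∀ y : EuclideanSpace ℝ (Fin d), ‖y‖ ≤ r → |c * inner ℝ v y| ≤ M := by
    intro y hy
    rw [abs_mul]
    refine mul_le_mul_of_nonneg_left ((abs_real_inner_le_norm v y).trans ?_) (abs_nonneg c)
    exact mul_le_mul_of_nonneg_left hy (norm_nonneg v)
  have hexp : ∀ (s : ℂ) (y : EuclideanSpace ℝ (Fin d)), ‖y‖ ≤ r →
      ‖Complex.exp (Complex.I * (((c * inner ℝ x y : ℝ) : ℂ) + s * ((c * inner ℝ v y : ℝ) : ℂ)))‖ ≤
        Real.exp (‖s‖ * M) := by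
    intro s y hy
    rw [Complex.norm_exp]
    refine Real.exp_le_exp.2 ?_
    have : (Complex.I * (((c * inner ℝ x y : ℝ) : ℂ) + s * ((c * inner ℝ v y : ℝ) : ℂ))).re =
        -(s.im * (c * inner ℝ v y)) := by
      simp [-Complex.ofReal_mul]
    rw [this]
    refine (neg_le_abs _).trans ?_
    rw [abs_mul]
    exact mul_le_mul (Complex.abs_im_le_norm s) (hb y hy) (abs_nonneg _) (norm_nonneg _)
  have hmeas : ∀ s : ℂ, AEStronglyMeasurable (fun y => Complex.exp (Complex.I *
      (((c * inner ℝ x y : ℝ) : ℂ) + s * ((c * inner ℝ v y : ℝ) : ℂ)))) ν := fun s =>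
    Continuous.aestronglyMeasurable (by fun_prop)
  have hder := hasDerivAt_integral_of_dominated_loc_of_deriv_le (μ := ν) (𝕜 := ℂ)
    (F := fun (s : ℂ) y => Complex.exp (Complex.I *
      (((c * inner ℝ x y : ℝ) : ℂ) + s * ((c * inner ℝ v y : ℝ) : ℂ))) * h y)
    (F' := fun (s : ℂ) y => Complex.exp (Complex.I *
      (((c * inner ℝ x y : ℝ) : ℂ) + s * ((c * inner ℝ v y : ℝ) : ℂ))) *
        (Complex.I * ((c * inner ℝ v y : ℝ) : ℂ)) * h y)
    (x₀ := s₀) (s := Metric.ball s₀ 1)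
    -- On the unit ball around `s₀` one has `‖s‖ ≤ ‖s₀‖ + 1`; the extra `M` bounds the
    -- differentiated exponent.
    (bound := fun y => Real.exp ((‖s₀‖ + 1) * M) * M * ‖h y‖)
    (Metric.ball_mem_nhds s₀ one_pos) (Eventually.of_forall fun s => (hmeas s).mul hh.1)
    (hh.bdd_mul (c := Real.exp (‖s₀‖ * M)) (hmeas s₀) (hν.mono fun y hy => hexp s₀ y hy))
    (((hmeas s₀).mul (Continuous.aestronglyMeasurable (by fun_prop))).mul hh.1)
    (hν.mono fun y hy s hs => ?_) (hh.norm.const_mul _)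
    (Eventually.of_forall fun y s hs => ?_)
  · exact hder.2.differentiableAt
  · have hM0 : 0 ≤ M := (abs_nonneg _).trans (hb y hy)
    rw [norm_mul, norm_mul, norm_mul, Complex.norm_I, one_mul, Complex.norm_real, Real.norm_eq_abs]
    refine mul_le_mul_of_nonneg_right ?_ (norm_nonneg _)
    refine mul_le_mul ((hexp s y hy).trans ?_) (hb y hy) (abs_nonneg _) (Real.exp_pos _).le
    refine Real.exp_le_exp.2 (mul_le_mul_of_nonneg_right ?_ hM0)
    have h1 : ‖s - s₀‖ < 1 := by simpa [dist_eq_norm] using hs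
    have h2 := norm_le_norm_add_norm_sub' s s₀
    linarith
  · have h1 : HasDerivAt (fun s : ℂ => Complex.I *
        (((c * inner ℝ x y : ℝ) : ℂ) + s * ((c * inner ℝ v y : ℝ) : ℂ)))
        (Complex.I * ((c * inner ℝ v y : ℝ) : ℂ)) s := by
      have := (((hasDerivAt_id s).mul_const ((c * inner ℝ v y : ℝ) : ℂ)).const_add
        ((c * inner ℝ x y : ℝ) : ℂ)).const_mul Complex.I
      simpa using this
    exact h1.cexp.mul_const _

/-- Along the line from a point `x₀` of `U` to `x` the transform is entire and vanishes for small
real parameters. The identity theorem in one variable makes it vanish at parameter `1`, that is, at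
`x`. -/
theorem expTransform_eq_zero_of_eqOn_open (ν : Measure (EuclideanSpace ℝ (Fin d))) {r : ℝ}
    (hν : ∀ᵐ y ∂ν, ‖y‖ ≤ r) (c : ℝ) {h : EuclideanSpace ℝ (Fin d) → ℂ} (hh : Integrable h ν)
    {U : Set (EuclideanSpace ℝ (Fin d))} (hU : IsOpen U) (hne : U.Nonempty)
    (h0 : ∀ x ∈ U, ∫ y, Complex.exp (Complex.I * ((c * inner ℝ x y : ℝ) : ℂ)) * h y ∂ν = 0)
    (x : EuclideanSpace ℝ (Fin d)) :
    ∫ y, Complex.exp (Complex.I * ((c * inner ℝ x y : ℝ) : ℂ)) * h y ∂ν = 0 := by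
  obtain ⟨x₀, hx₀⟩ := hne
  set G : ℂ → ℂ := fun s => ∫ y, Complex.exp (Complex.I *
    (((c * inner ℝ x₀ y : ℝ) : ℂ) + s * ((c * inner ℝ (x - x₀) y : ℝ) : ℂ))) * h y ∂ν with hG
  have hGd : Differentiable ℂ G := differentiable_expTransform_line ν hν c hh x₀ (x - x₀)
  have hGr : ∀ t : ℝ, G t = ∫ y, Complex.exp (Complex.I *
      ((c * inner ℝ (x₀ + t • (x - x₀)) y : ℝ) : ℂ)) * h y ∂ν := by
    intro t
    simp only [hG]
    congr 1; ext y
    rw [inner_add_left, real_inner_smul_left]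
    congr 3
    push_cast
    ring
  have hev : ∀ᶠ t : ℝ in 𝓝 0, G t = 0 := by
    have hcont : Continuous fun t : ℝ => x₀ + t • (x - x₀) := by fun_prop
    have : ∀ᶠ t : ℝ in 𝓝 0, x₀ + t • (x - x₀) ∈ U :=
      hcont.continuousAt.eventually (hU.mem_nhds (by simpa using hx₀))
    filter_upwards [this] with t ht
    rw [hGr, h0 _ ht]
  have hfreq : ∃ᶠ z : ℂ in 𝓝[≠] 0, G z = 0 := by
    have h1 : Tendsto (fun t : ℝ => (t : ℂ)) (𝓝[≠] 0) (𝓝[≠] 0) := by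
      refine tendsto_nhdsWithin_iff.2 ⟨?_, ?_⟩
      · exact (Complex.continuous_ofReal.tendsto' 0 0 Complex.ofReal_zero).mono_left
          nhdsWithin_le_nhds
      · filter_upwards [self_mem_nhdsWithin] with t ht
        simpa using ht
    exact h1.frequently (hev.filter_mono nhdsWithin_le_nhds).frequently
  have hzero := (hGd.differentiableOn.analyticOnNhd isOpen_univ).eqOn_zero_of_preconnected_of_frequently_eq_zero
    isPreconnected_univ (mem_univ 0) hfreq
  have h1 := hGr 1
  rw [one_smul, add_sub_cancel] at h1
  rw [← h1]
  exact hzero (mem_univ _)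

end Fourier

/-! ### Factorization of the data operator -/

section Operators

variable {d : ℕ}

theorem memLp_expTransform (c : ℝ) (w : EuclideanSpace ℝ (Fin d) → ℂ) :
    MemLp (fun t => ∫ y in unitBall d,
      Complex.exp (Complex.I * ((c * inner ℝ t y : ℝ) : ℂ)) * w y) 2
      (volume.restrict (unitBall d)) :=
  MemLp.of_bound (continuous_expTransform _ c _).aestronglyMeasurable _
    (Eventually.of_forall (norm_expTransform_le _ c w))

/-- The restricted Fourier operator `(K w)(t) = ∫_B exp(i c t·y) w(y) dy` on `L²(B)`. -/
def expOp {d : ℕ} (c : ℝ) : L2B d →L[ℂ] L2B d :=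
  LinearMap.mkContinuousOfExistsBound
    { toFun := fun w => (memLp_expTransform c w).toLp
        (fun t => ∫ y in unitBall d, Complex.exp (Complex.I * ((c * inner ℝ t y : ℝ) : ℂ)) * w y)
      map_add' := by
        intro g h
        rw [← MemLp.toLp_add]
        refine MemLp.toLp_congr _ _ (Eventually.of_forall fun t => ?_)
        simp only [Pi.add_apply]
        rw [← integral_add (integrable_exp_mul c _ (integrable_L2B g) t)
          (integrable_exp_mul c _ (integrable_L2B h) t)]
        refine integral_congr_ae ?_
        filter_upwards [Lp.coeFn_add g h] with s hs
        rw [hs, Pi.add_apply, mul_add]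
      map_smul' := by
        intro a g
        rw [RingHom.id_apply, ← MemLp.toLp_const_smul]
        refine MemLp.toLp_congr _ _ (Eventually.of_forall fun t => ?_)
        simp only [Pi.smul_apply]
        rw [← integral_smul]
        refine integral_congr_ae ?_
        filter_upwards [Lp.coeFn_smul a g] with s hs
        rw [hs, Pi.smul_apply, smul_eq_mul, smul_eq_mul]
        ring }
    (by
      obtain ⟨K, hK, hg⟩ := exists_integral_norm_le d
      refine ⟨(measureUnivNNReal (volume.restrict (unitBall d)) : ℝ) ^
        ((2 : ENNReal).toReal)⁻¹ * K, fun g => ?_⟩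
      rw [mul_assoc]
      refine Lp.norm_le_of_ae_bound (by positivity) ?_
      filter_upwards [MemLp.coeFn_toLp (memLp_expTransform c g)] with t ht
      simp only [LinearMap.coe_mk, AddHom.coe_mk]
      rw [ht]
      exact (norm_expTransform_le _ c _ t).trans (hg g))

theorem coeFn_expOp (c : ℝ) (w : L2B d) :
    expOp c w =ᵐ[volume.restrict (unitBall d)] fun t =>
      ∫ y in unitBall d, Complex.exp (Complex.I * ((c * inner ℝ t y : ℝ) : ℂ)) * w y :=
  MemLp.coeFn_toLp (memLp_expTransform c w)

theorem coeFn_dataOperator (c : ℝ) (q : EuclideanSpace ℝ (Fin d) → ℝ) (g : L2B d) :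
    dataOperator c q g =ᵐ[volume.restrict (unitBall d)] fun t =>
      ∫ s in unitBall d, data c q ((1 / 2 : ℝ) • (t - s)) * g s :=
  MemLp.coeFn_toLp (memLp_kernel_integral c q g)

theorem integrable_exp_mul_prod {f g : EuclideanSpace ℝ (Fin d) → ℂ}
    {ν : Measure (EuclideanSpace ℝ (Fin d))} [SFinite ν] (hf : Integrable f ν)
    (hg : Integrable g ν) {L : EuclideanSpace ℝ (Fin d) × EuclideanSpace ℝ (Fin d) → ℝ}
    (hL : Continuous L) :
    Integrable (fun z => Complex.exp (Complex.I * (L z : ℂ)) * (f z.1 * g z.2)) (ν.prod ν) :=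
  (hf.mul_prod hg).bdd_mul (c := 1) (Continuous.aestronglyMeasurable (by fun_prop))
    (Eventually.of_forall fun z => (norm_expI _).le)

theorem adjoint_expOp (c : ℝ) : (expOp c : L2B d →L[ℂ] L2B d).adjoint = expOp (-c) := by
  symm
  rw [ContinuousLinearMap.eq_adjoint_iff]
  intro x y
  rw [L2.inner_def, L2.inner_def]
  have h1 : ∫ t in unitBall d, inner ℂ ((expOp (-c) x : L2B d) t) (y t) =
      ∫ t in unitBall d, ∫ s in unitBall d, Complex.exp (Complex.I * ((c * inner ℝ t s : ℝ) : ℂ)) *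
        (y t * (starRingEnd ℂ) (x s)) := by
    refine integral_congr_ae ?_
    filter_upwards [coeFn_expOp (-c) x] with t ht
    rw [RCLike.inner_apply, ht, ← integral_conj, ← integral_const_mul]
    congr 1; ext s
    rw [map_mul, ← Complex.exp_conj, map_mul, Complex.conj_I, Complex.conj_ofReal]
    push_cast
    ring_nf
  have h2 : ∫ s in unitBall d, inner ℂ (x s) ((expOp c y : L2B d) s) =
      ∫ s in unitBall d, ∫ t in unitBall d, Complex.exp (Complex.I * ((c * inner ℝ t s : ℝ) : ℂ)) *
        (y t * (starRingEnd ℂ) (x s)) := by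
    refine integral_congr_ae ?_
    filter_upwards [coeFn_expOp c y] with s hs
    rw [RCLike.inner_apply, hs, ← integral_mul_const]
    congr 1; ext t
    rw [real_inner_comm, mul_assoc]
  rw [h1, h2]
  refine integral_integral_swap ?_
  exact integrable_exp_mul_prod (f := y) (g := fun s => (starRingEnd ℂ) (x s))
    (integrable_L2B y)
    ((LinearIsometryEquiv.integrable_comp_iff Complex.conjLIE).2 (integrable_L2B x))
    (L := fun z => c * inner ℝ z.1 z.2) (by fun_prop)

/-- Multiplication by a bounded function. -/
def mulOp {p : EuclideanSpace ℝ (Fin d) → ℂ} (hp : MemLp p ⊤ (volume.restrict (unitBall d))) :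
    L2B d →L[ℂ] L2B d :=
  (ContinuousLinearMap.mul ℂ ℂ).holderL (volume.restrict (unitBall d)) ⊤ 2 2 (hp.toLp p)

theorem coeFn_mulOp {p : EuclideanSpace ℝ (Fin d) → ℂ}
    (hp : MemLp p ⊤ (volume.restrict (unitBall d))) (w : L2B d) :
    mulOp hp w =ᵐ[volume.restrict (unitBall d)] fun t => p t * w t := by
  have h : mulOp hp w =ᵐ[volume.restrict (unitBall d)] fun t => (hp.toLp p) t * w t :=
    (ContinuousLinearMap.mul ℂ ℂ).coeFn_holder (hp.toLp p) w
  filter_upwards [h, hp.coeFn_toLp] with t ht hpt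
  rw [ht, hpt]

theorem adjoint_mulOp {p : EuclideanSpace ℝ (Fin d) → ℝ}
    (hp : MemLp (fun y => (p y : ℂ)) ⊤ (volume.restrict (unitBall d))) :
    (mulOp hp).adjoint = mulOp hp := by
  symm
  rw [ContinuousLinearMap.eq_adjoint_iff]
  intro x y
  rw [L2.inner_def, L2.inner_def]
  refine integral_congr_ae ?_
  filter_upwards [coeFn_mulOp hp x, coeFn_mulOp hp y] with t hx hy
  rw [RCLike.inner_apply, RCLike.inner_apply, hx, hy, map_mul, Complex.conj_ofReal]
  ring

/-- The factor `T = K M_p` with `N = T T*` for `q = p²`. -/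
def factorOp (c : ℝ) {p : EuclideanSpace ℝ (Fin d) → ℝ}
    (hp : MemLp (fun y => (p y : ℂ)) ⊤ (volume.restrict (unitBall d))) : L2B d →L[ℂ] L2B d :=
  expOp c ∘L mulOp hp

theorem adjoint_factorOp (c : ℝ) {p : EuclideanSpace ℝ (Fin d) → ℝ}
    (hp : MemLp (fun y => (p y : ℂ)) ⊤ (volume.restrict (unitBall d))) :
    (factorOp c hp).adjoint = mulOp hp ∘L expOp (-c) := by
  rw [factorOp, ContinuousLinearMap.adjoint_comp, adjoint_mulOp, adjoint_expOp]

/-- The `2` in the phase of `data` cancels the `1/2` in the kernel, so the phase splits as `c t·y -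
c y·s`; Fubini then separates the two transforms. -/
theorem dataOperator_eq_factorOp_comp_adjoint (c : ℝ) {p q : EuclideanSpace ℝ (Fin d) → ℝ}
    (hp : MemLp (fun y => (p y : ℂ)) ⊤ (volume.restrict (unitBall d)))
    (hpq : ∀ᵐ y ∂volume.restrict (unitBall d), q y = p y * p y) :
    dataOperator c q = factorOp c hp ∘L (factorOp c hp).adjoint := by
  have hq : Integrable (fun y => (q y : ℂ)) (volume.restrict (unitBall d)) := by
    have h := (hp.mul (r := ⊤) hp).integrable (by simp)
    refine h.congr (hpq.mono fun y hy => ?_)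
    simp [hy]
  rw [adjoint_factorOp]
  ext1 g
  refine Lp.ext ?_
  filter_upwards [coeFn_dataOperator c q g,
    coeFn_expOp c (mulOp hp (mulOp hp (expOp (-c) g)))] with t h1 h2
  rw [h1]
  refine Eq.trans ?_ h2.symm
  have h3 : ∫ y in unitBall d, Complex.exp (Complex.I * ((c * inner ℝ t y : ℝ) : ℂ)) *
      (mulOp hp (mulOp hp (expOp (-c) g)) : L2B d) y =
      ∫ y in unitBall d, ∫ s in unitBall d, Complex.exp (Complex.I *
        ((c * inner ℝ t y - c * inner ℝ y s : ℝ) : ℂ)) * ((q y : ℂ) * g s) := by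
    refine integral_congr_ae ?_
    filter_upwards [coeFn_mulOp hp (mulOp hp (expOp (-c) g)), coeFn_mulOp hp (expOp (-c) g),
      coeFn_expOp (-c) g, hpq] with y e1 e2 e3 e4
    rw [e1, e2, e3, e4, ← integral_const_mul, ← integral_const_mul, ← integral_const_mul]
    congr 1; ext s
    rw [Complex.ofReal_sub, sub_eq_add_neg, mul_add, Complex.exp_add]
    push_cast
    ring_nf
  have h4 : ∫ s in unitBall d, data c q ((1 / 2 : ℝ) • (t - s)) * g s =
      ∫ s in unitBall d, ∫ y in unitBall d, Complex.exp (Complex.I *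
        ((c * inner ℝ t y - c * inner ℝ y s : ℝ) : ℂ)) * ((q y : ℂ) * g s) := by
    congr 1; ext s
    rw [data, ← integral_mul_const]
    congr 1; ext y
    rw [real_inner_smul_left, inner_sub_left, real_inner_comm y s, mul_assoc]
    congr 4
    ring
  rw [h3, h4]
  refine (integral_integral_swap ?_).symm
  exact integrable_exp_mul_prod (f := fun y => (q y : ℂ)) (g := g) hq (integrable_L2B g)
    (L := fun z => c * inner ℝ t z.1 - c * inner ℝ z.1 z.2) (by fun_prop)

theorem ae_norm_le_one : ∀ᵐ y ∂volume.restrict (unitBall d), ‖y‖ ≤ 1 := by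
  filter_upwards [ae_restrict_mem Metric.isOpen_ball.measurableSet] with y hy
  exact (mem_ball_zero_iff.1 hy).le

/-- Continuity upgrades vanishing a.e. on `U` to vanishing on `U`, analyticity to vanishing
everywhere, and Fourier injectivity applies to `h` extended by zero. -/
theorem ae_restrict_eq_zero_of_expTransform_eq_zero {c : ℝ} (hc : c ≠ 0)
    {h : EuclideanSpace ℝ (Fin d) → ℂ} (hh : Integrable h (volume.restrict (unitBall d)))
    {U : Set (EuclideanSpace ℝ (Fin d))} (hU : IsOpen U) (hne : U.Nonempty)
    (h0 : ∀ᵐ x ∂volume.restrict U,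
      ∫ y in unitBall d, Complex.exp (Complex.I * ((c * inner ℝ x y : ℝ) : ℂ)) * h y = 0) :
    h =ᵐ[volume.restrict (unitBall d)] 0 := by
  have hB : MeasurableSet (unitBall d) := Metric.isOpen_ball.measurableSet
  have h1 := Measure.eqOn_open_of_ae_eq (g := fun _ => (0 : ℂ)) h0 hU
    (continuous_expTransform (volume.restrict (unitBall d)) c h).continuousOn continuousOn_const
  have h2 := expTransform_eq_zero_of_eqOn_open (volume.restrict (unitBall d)) ae_norm_le_one c hh
    hU hne h1
  have h3 := ae_eq_zero_of_expTransform_eq_zero (h := (unitBall d).indicator h) hc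
    ((integrable_indicator_iff hB).2 hh) fun x => by
      rw [← h2 x, ← integral_indicator hB]
      congr 1; ext y
      by_cases hy : y ∈ unitBall d <;> simp [hy]
  exact (ae_restrict_iff' hB).2 (h3.mono fun y hy hyB => by simpa [hyB] using hy)

end Operators

/-! ### Compactness of the Fourier operator and infinite dimension of the space -/

section Compact

variable {d : ℕ}

theorem exists_simpleFunc_near (d : ℕ) {δ : ℝ} (hδ : 0 < δ) :
    ∃ s : SimpleFunc (EuclideanSpace ℝ (Fin d)) (EuclideanSpace ℝ (Fin d)),
      ∀ t ∈ unitBall d, dist t (s t) ≤ δ := by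
  let e := TopologicalSpace.denseSeq (EuclideanSpace ℝ (Fin d))
  have hcov : Metric.closedBall (0 : EuclideanSpace ℝ (Fin d)) 1 ⊆ ⋃ n, Metric.ball (e n) δ := by
    intro x _
    obtain ⟨n, hn⟩ := (TopologicalSpace.denseRange_denseSeq (EuclideanSpace ℝ (Fin d))).exists_dist_lt x hδ
    exact mem_iUnion.2 ⟨n, hn⟩
  obtain ⟨F, hF⟩ := (isCompact_closedBall (0 : EuclideanSpace ℝ (Fin d)) 1).elim_finite_subcover _
    (fun n => Metric.isOpen_ball) hcov
  refine ⟨SimpleFunc.nearestPt e (F.sup id), fun t ht => ?_⟩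
  obtain ⟨n, hn, htn⟩ := mem_iUnion₂.1 (hF (Metric.ball_subset_closedBall ht))
  have h1 := SimpleFunc.edist_nearestPt_le e t (Finset.le_sup (f := id) hn)
  rw [edist_dist, edist_dist, ENNReal.ofReal_le_ofReal_iff dist_nonneg] at h1
  rw [dist_comm]
  refine h1.trans ?_
  rw [dist_comm]
  exact (Metric.mem_ball.1 htn).le

theorem norm_expI_sub_le (a b : ℝ) :
    ‖Complex.exp (Complex.I * (a : ℂ)) - Complex.exp (Complex.I * (b : ℂ))‖ ≤ |a - b| := by
  have h : Complex.exp (Complex.I * (a : ℂ)) - Complex.exp (Complex.I * (b : ℂ)) =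
      Complex.exp (Complex.I * (b : ℂ)) * (Complex.exp (Complex.I * ((a - b : ℝ) : ℂ)) - 1) := by
    rw [mul_sub, ← Complex.exp_add, mul_one]
    congr 2
    push_cast
    ring
  rw [h, norm_mul, norm_expI, one_mul]
  exact Real.norm_exp_I_mul_ofReal_sub_one_le

theorem norm_expTransform_sub_le (c : ℝ) {w : EuclideanSpace ℝ (Fin d) → ℂ}
    (hw : Integrable w (volume.restrict (unitBall d))) (t x : EuclideanSpace ℝ (Fin d)) :
    ‖(∫ y in unitBall d, Complex.exp (Complex.I * ((c * inner ℝ t y : ℝ) : ℂ)) * w y) -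
      ∫ y in unitBall d, Complex.exp (Complex.I * ((c * inner ℝ x y : ℝ) : ℂ)) * w y‖ ≤
      |c| * dist t x * ∫ y in unitBall d, ‖w y‖ := by
  rw [← integral_sub (integrable_exp_mul c _ hw t) (integrable_exp_mul c _ hw x),
    ← integral_const_mul]
  refine norm_integral_le_of_norm_le (hw.norm.const_mul _) ?_
  filter_upwards [ae_norm_le_one] with y hy
  rw [← sub_mul, norm_mul]
  refine mul_le_mul_of_nonneg_right ((norm_expI_sub_le _ _).trans ?_) (norm_nonneg _)
  rw [← mul_sub, ← inner_sub_left, abs_mul, dist_eq_norm]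
  refine mul_le_mul_of_nonneg_left ((abs_real_inner_le_norm _ _).trans ?_) (abs_nonneg _)
  exact mul_le_of_le_one_right (norm_nonneg _) hy

theorem memLp_exp (c : ℝ) (x : EuclideanSpace ℝ (Fin d)) :
    MemLp (fun y => Complex.exp (Complex.I * ((c * inner ℝ x y : ℝ) : ℂ))) 2
      (volume.restrict (unitBall d)) :=
  MemLp.of_bound (Continuous.aestronglyMeasurable (by fun_prop)) 1
    (Eventually.of_forall fun _ => (norm_expI _).le)

theorem inner_exp (c : ℝ) (x : EuclideanSpace ℝ (Fin d)) (w : L2B d) :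
    inner ℂ ((memLp_exp (-c) x).toLp) w =
      ∫ y in unitBall d, Complex.exp (Complex.I * ((c * inner ℝ x y : ℝ) : ℂ)) * w y := by
  rw [L2.inner_def]
  refine integral_congr_ae ?_
  filter_upwards [(memLp_exp (-c) x).coeFn_toLp] with y hy
  rw [RCLike.inner_apply, hy, ← Complex.exp_conj, map_mul, Complex.conj_I, Complex.conj_ofReal,
    mul_comm]
  push_cast
  ring_nf

theorem isCompactOperator_sum_rankOne {H ι : Type*} [NormedAddCommGroup H] [InnerProductSpace ℂ H]
    (s : Finset ι) (u v : ι → H) :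
    IsCompactOperator (∑ x ∈ s, InnerProductSpace.rankOne ℂ (u x) (v x) : H →L[ℂ] H) := by
  classical
  induction s using Finset.induction_on with
  | empty => exact isCompactOperator_zero
  | insert a s ha ih =>
    rw [Finset.sum_insert ha]
    refine IsCompactOperator.add (f := InnerProductSpace.rankOne ℂ (u a) (v a)) ?_ ih
    exact (isCompactOperator_of_locallyCompactSpace_dom (innerSL ℂ (v a))).clm_comp
      (ContinuousLinearMap.toSpanSingleton ℂ (u a))

/-- The restricted Fourier operator is a norm limit of finite rank operators. -/
theorem isCompactOperator_expOp (c : ℝ) : IsCompactOperator (expOp c : L2B d →L[ℂ] L2B d) := by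
  classical
  obtain ⟨K, hK, hg⟩ := exists_integral_norm_le d
  set V : ℝ := (measureUnivNNReal (volume.restrict (unitBall d)) : ℝ) ^ ((2 : ENNReal).toReal)⁻¹
    with hV
  have hV0 : 0 ≤ V := by positivity
  have hB : MeasurableSet (unitBall d) := Metric.isOpen_ball.measurableSet
  refine (isClosed_setOfPred_isCompactOperator (σ₁₂ := RingHom.id ℂ)).closure_subset
    (Metric.mem_closure_iff.2 fun ε hε => ?_)
  obtain ⟨δ, hδ, hδε⟩ : ∃ δ : ℝ, 0 < δ ∧ V * (|c| * δ * K) < ε := by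
    have h : ContinuousAt (fun δ : ℝ => V * (|c| * δ * K)) 0 := by fun_prop
    have h2 : ∀ᶠ δ in 𝓝[>] (0 : ℝ), V * (|c| * δ * K) < ε :=
      (h.tendsto.eventually (gt_mem_nhds (by simpa using hε))).filter_mono nhdsWithin_le_nhds
    obtain ⟨δ, h1, h2⟩ := (h2.and self_mem_nhdsWithin).exists
    exact ⟨δ, h2, h1⟩
  obtain ⟨s, hs⟩ := exists_simpleFunc_near d hδ
  let b : EuclideanSpace ℝ (Fin d) → L2B d := fun x =>
    indicatorConstLp 2 (s.measurableSet_fiber x) (measure_ne_top _ _) (1 : ℂ)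
  -- `A` is `expOp c` with the output variable `t` rounded to the net point `s t`, so it has finite
  -- rank; the Lipschitz bound in `t` controls the error.
  let A : L2B d →L[ℂ] L2B d :=
    ∑ x ∈ s.range, InnerProductSpace.rankOne ℂ (b x) ((memLp_exp (-c) x).toLp)
  have hA : ∀ w, A w =ᵐ[volume.restrict (unitBall d)] fun t =>
      ∫ y in unitBall d, Complex.exp (Complex.I * ((c * inner ℝ (s t) y : ℝ) : ℂ)) * w y := by
    intro w
    have h1 : A w = ∑ x ∈ s.range, (∫ y in unitBall d,
        Complex.exp (Complex.I * ((c * inner ℝ x y : ℝ) : ℂ)) * w y) • b x := by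
      simp only [A, sum_apply, InnerProductSpace.rankOne_apply, inner_exp]
    rw [h1]
    have h2 : ∀ᵐ t ∂volume.restrict (unitBall d), ∀ x ∈ s.range,
        b x t = (s ⁻¹' {x}).indicator (fun _ => (1 : ℂ)) t :=
      (Finset.eventually_all s.range).2 fun x _ => indicatorConstLp_coeFn
    have h3 : ∀ᵐ t ∂volume.restrict (unitBall d), ∀ x ∈ s.range,
        ((∫ y in unitBall d, Complex.exp (Complex.I * ((c * inner ℝ x y : ℝ) : ℂ)) * w y) • b x :
          L2B d) t = (∫ y in unitBall d,
            Complex.exp (Complex.I * ((c * inner ℝ x y : ℝ) : ℂ)) * w y) • b x t :=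
      (Finset.eventually_all s.range).2 fun x _ => Lp.coeFn_smul _ _
    filter_upwards [Lp.coeFn_finsetSum s.range fun x => (∫ y in unitBall d,
        Complex.exp (Complex.I * ((c * inner ℝ x y : ℝ) : ℂ)) * w y) • b x, h2, h3] with t e1 e2 e3
    rw [e1, Finset.sum_apply, Finset.sum_eq_single_of_mem (s t) (s.mem_range_self t)]
    · rw [e3 _ (s.mem_range_self t), e2 _ (s.mem_range_self t)]
      simp
    · intro x hx hne
      rw [e3 _ hx, e2 _ hx]
      simp [hne.symm]
  refine ⟨A, ?_, ?_⟩
  · exact isCompactOperator_sum_rankOne _ _ _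
  · rw [dist_eq_norm]
    have hle : ∀ w : L2B d, ‖(expOp c - A : L2B d →L[ℂ] L2B d) w‖ ≤ V * (|c| * δ * K) * ‖w‖ := by
      intro w
      have h : ‖expOp c w - A w‖ ≤ V * (|c| * δ * (K * ‖w‖)) := by
        refine Lp.norm_le_of_ae_bound (by positivity) ?_
        filter_upwards [Lp.coeFn_sub (expOp c w) (A w), coeFn_expOp c w, hA w,
          ae_restrict_mem hB] with t e1 e2 e3 ht
        rw [e1, Pi.sub_apply, e2, e3]
        refine (norm_expTransform_sub_le c (integrable_L2B w) t (s t)).trans ?_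
        exact mul_le_mul (mul_le_mul_of_nonneg_left (hs t ht) (abs_nonneg _)) (hg w)
          (integral_nonneg fun _ => norm_nonneg _) (by positivity)
      refine h.trans (le_of_eq ?_)
      ring
    exact (ContinuousLinearMap.opNorm_le_bound _ (by positivity) hle).trans_lt hδε

theorem not_finiteDimensional_L2B (hd : d ≠ 0) : ¬ FiniteDimensional ℂ (L2B d) := by
  intro hfd
  have : Nonempty (Fin d) := ⟨⟨0, Nat.pos_of_ne_zero hd⟩⟩
  have hB : MeasurableSet (unitBall d) := Metric.isOpen_ball.measurableSet
  -- Disjoint open shells inside the ball: their indicators are nonzero and mutually orthogonal.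
  let S : ℕ → Set (EuclideanSpace ℝ (Fin d)) := fun n =>
    {x | ‖x‖ ∈ Ioo (1 / ((n : ℝ) + 2)) (1 / ((n : ℝ) + 1))}
  have hSo : ∀ n, IsOpen (S n) := fun n => isOpen_Ioo.preimage continuous_norm
  have hSB : ∀ n, S n ⊆ unitBall d := fun n x hx => by
    rw [mem_ball_zero_iff]
    refine hx.2.trans_le ?_
    rw [div_le_one (by positivity)]
    linarith [(Nat.cast_nonneg n : (0 : ℝ) ≤ n)]
  have hSne : ∀ n, (S n).Nonempty := fun n => by
    have h : (1 / ((n : ℝ) + 2)) < (1 / ((n : ℝ) + 1)) :=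
      one_div_lt_one_div_of_lt (by positivity) (by linarith)
    obtain ⟨r, hr⟩ := exists_between h
    have h0 : 0 ≤ r := (by positivity : (0 : ℝ) ≤ 1 / ((n : ℝ) + 2)).trans hr.1.le
    obtain ⟨x, hx⟩ := exists_norm_eq (EuclideanSpace ℝ (Fin d)) h0
    exact ⟨x, by simpa [S, hx] using hr⟩
  have hdisj : ∀ m n, m < n → Disjoint (S m) (S n) := fun m n hmn => by
    rw [Set.disjoint_left]
    intro x h1 h2
    have h3 : (1 / ((n : ℝ) + 1)) ≤ (1 / ((m : ℝ) + 2)) := by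
      refine one_div_le_one_div_of_le (by positivity) ?_
      have : (m : ℝ) + 1 ≤ n := by exact_mod_cast hmn
      linarith
    exact lt_asymm (h1.1.trans_le' h3) h2.2
  have hdisj' : ∀ m n, m ≠ n → Disjoint (S m) (S n) := fun m n hmn => by
    rcases lt_or_gt_of_ne hmn with h | h
    · exact hdisj m n h
    · exact (hdisj n m h).symm
  let b : ℕ → L2B d := fun n =>
    indicatorConstLp 2 (hSo n).measurableSet (measure_ne_top _ _) (1 : ℂ)
  have hli : LinearIndependent ℂ b := by
    refine linearIndependent_of_ne_zero_of_inner_eq_zero (fun n => ?_) fun m n hmn => ?_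
    · have h1 : inner ℂ (b n) (b n) = ((volume.restrict (unitBall d)).real (S n ∩ S n) : ℂ) :=
        L2.inner_indicatorConstLp_one_indicatorConstLp_one _ _
      rw [inter_self, measureReal_restrict_apply (hSo n).measurableSet,
        inter_eq_left.2 (hSB n)] at h1
      intro h0
      rw [h0, inner_zero_left, eq_comm, Complex.ofReal_eq_zero, measureReal_def,
        ENNReal.toReal_eq_zero_iff] at h1
      rcases h1 with h1 | h1
      · exact ((hSo n).measure_pos volume (hSne n)).ne' h1
      · exact ((measure_mono (hSB n)).trans_lt measure_ball_lt_top).ne h1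
    · have h1 : inner ℂ (b m) (b n) = ((volume.restrict (unitBall d)).real (S m ∩ S n) : ℂ) :=
        L2.inner_indicatorConstLp_one_indicatorConstLp_one _ _
      change inner ℂ (b m) (b n) = 0
      rw [h1, (hdisj' m n hmn).inter_eq]
      simp
  exact not_finite_iff_infinite.2 (inferInstance : Infinite ℕ) hli.finite

end Compact

/-! ### Range test for the sampling region -/

section Range

variable {d : ℕ} {c : ℝ} {p : EuclideanSpace ℝ (Fin d) → ℝ}
  {Ω R : Set (EuclideanSpace ℝ (Fin d))}

/-- Dividing `p · K* g = 0` by `p > 0` on `Ω` shows that the transform of `g` vanishes on an open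
set. -/
theorem adjoint_factorOp_injective (hc : c ≠ 0)
    (hp : MemLp (fun y => (p y : ℂ)) ⊤ (volume.restrict (unitBall d))) (hΩ : IsOpen Ω)
    (hne : Ω.Nonempty) (hΩB : Ω ⊆ unitBall d) (hpos : ∀ᵐ y ∂volume.restrict Ω, 0 < p y) (g : L2B d)
    (hg : (factorOp c hp).adjoint g = 0) : g = 0 := by
  rw [adjoint_factorOp] at hg
  have h1 : mulOp hp (expOp (-c) g) =ᵐ[volume.restrict (unitBall d)] 0 := by
    have : mulOp hp (expOp (-c) g) = 0 := hg
    rw [this]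
    exact Lp.coeFn_zero _ _ _
  have h2 : ∀ᵐ t ∂volume.restrict (unitBall d), (p t : ℂ) *
      ∫ y in unitBall d, Complex.exp (Complex.I * ((-c * inner ℝ t y : ℝ) : ℂ)) * g y = 0 := by
    filter_upwards [h1, coeFn_mulOp hp (expOp (-c) g), coeFn_expOp (-c) g] with t e1 e2 e3
    rw [← e3, ← e2, e1, Pi.zero_apply]
  have h3 := ae_restrict_eq_zero_of_expTransform_eq_zero (neg_ne_zero.2 hc) (integrable_L2B g) hΩ
    hne (by
      filter_upwards [ae_restrict_of_ae_restrict_of_subset hΩB h2, hpos] with t e1 e2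
      exact (mul_eq_zero.1 e1).resolve_left (Complex.ofReal_ne_zero.2 e2.ne'))
  exact (Lp.eq_zero_iff_ae_eq_zero).2 h3

theorem measurable_normalizedIndicator (hR : MeasurableSet R) :
    Measurable (normalizedIndicator R) := measurable_const.indicator hR

theorem norm_normalizedIndicator_le (y : EuclideanSpace ℝ (Fin d)) :
    ‖normalizedIndicator R y‖ ≤ ‖((1 / (volume R).toReal : ℝ) : ℂ)‖ :=
  norm_indicator_le_norm_self _ _

theorem integrable_normalizedIndicator (hR : MeasurableSet R) :
    Integrable (normalizedIndicator R) (volume.restrict (unitBall d)) :=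
  Integrable.of_bound (measurable_normalizedIndicator hR).aestronglyMeasurable _
    (Eventually.of_forall norm_normalizedIndicator_le)

theorem testFun_eq_setIntegral (hRB : R ⊆ unitBall d) (t : EuclideanSpace ℝ (Fin d)) :
    testFun c R t = ∫ y in unitBall d,
      Complex.exp (Complex.I * ((c * inner ℝ t y : ℝ) : ℂ)) * normalizedIndicator R y := by
  refine (setIntegral_eq_integral_of_forall_compl_eq_zero fun y hy => ?_).symm
  rw [normalizedIndicator, indicator_of_notMem fun h => hy (hRB h), mul_zero]

theorem phi_mem_range_factorOp
    (hp : MemLp (fun y => (p y : ℂ)) ⊤ (volume.restrict (unitBall d))) (hR : MeasurableSet R)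
    (hRΩ : R ⊆ Ω) (hΩo : IsOpen Ω) (hΩB : Ω ⊆ unitBall d) {δ : ℝ} (hδ : 0 < δ)
    (hpos : ∀ᵐ y ∂volume.restrict Ω, δ ≤ p y) : phi c R ∈ range (factorOp c hp) := by
  have hB : MeasurableSet (unitBall d) := Metric.isOpen_ball.measurableSet
  have hposR : ∀ᵐ y ∂volume.restrict (unitBall d), y ∈ R → δ ≤ p y := by
    have h := (ae_restrict_iff' hΩo.measurableSet).1 hpos
    exact ae_restrict_of_ae (h.mono fun y hy hyR => hy (hRΩ hyR))
  -- The preimage is `E / p`. It is bounded because `p ≥ δ` on `R`; where `p = 0` the convention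
  -- `0⁻¹ = 0` is harmless, since `E` vanishes there almost everywhere.
  have hm : MemLp (fun y => (p y : ℂ)⁻¹ * normalizedIndicator R y) 2
      (volume.restrict (unitBall d)) := by
    refine MemLp.of_bound ?_ (δ⁻¹ * ‖((1 / (volume R).toReal : ℝ) : ℂ)‖) ?_
    · exact (hp.1.aemeasurable.inv.aestronglyMeasurable).mul
        (measurable_normalizedIndicator hR).aestronglyMeasurable
    · filter_upwards [hposR] with y hy
      by_cases hyR : y ∈ R
      · rw [norm_mul, norm_inv, Complex.norm_real, Real.norm_eq_abs,
          abs_of_pos (hδ.trans_le (hy hyR))]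
        exact mul_le_mul (inv_anti₀ hδ (hy hyR)) (norm_normalizedIndicator_le y) (norm_nonneg _)
          (by positivity)
      · rw [normalizedIndicator, indicator_of_notMem hyR, mul_zero, norm_zero]
        positivity
  refine ⟨hm.toLp, Lp.ext ?_⟩
  filter_upwards [coeFn_expOp c (mulOp hp hm.toLp), (memLp_testFun c R).coeFn_toLp] with t e1 e2
  refine e1.trans (Eq.trans ?_ e2.symm)
  rw [testFun_eq_setIntegral (hRΩ.trans hΩB)]
  refine integral_congr_ae ?_
  filter_upwards [coeFn_mulOp hp hm.toLp, hm.coeFn_toLp, hposR] with y e1 e2 e3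
  rw [e1, e2]
  by_cases hyR : y ∈ R
  · rw [mul_inv_cancel_left₀ (Complex.ofReal_ne_zero.2 (hδ.trans_le (e3 hyR)).ne')]
  · rw [normalizedIndicator, indicator_of_notMem hyR]
    simp

theorem phi_notMem_range_factorOp (hc : c ≠ 0)
    (hp : MemLp (fun y => (p y : ℂ)) ⊤ (volume.restrict (unitBall d))) (hR : MeasurableSet R)
    (hRB : R ⊆ unitBall d) (hRint : R ⊆ closure (interior R)) (hRΩ : ¬ R ⊆ closure Ω)
    (hzero : ∀ᵐ y, y ∉ Ω → p y = 0) : phi c R ∉ range (factorOp c hp) := by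
  rintro ⟨w, hw⟩
  obtain ⟨x, hxR, hxΩ⟩ := Set.not_subset.1 hRΩ
  -- The point `x` may lie on the boundary of `R`; `R ⊆ closure (interior R)` provides interior
  -- points near it, still outside `closure Ω`.
  set V := interior R ∩ (closure Ω)ᶜ with hV
  have hVo : IsOpen V := isOpen_interior.inter isClosed_closure.isOpen_compl
  have hVne : V.Nonempty := by
    obtain ⟨y, hy1, hy2⟩ := mem_closure_iff.1 (hRint hxR) _ isClosed_closure.isOpen_compl hxΩ
    exact ⟨y, hy2, hy1⟩
  have hVR : V ⊆ R := inter_subset_left.trans interior_subset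
  have hVB : V ⊆ unitBall d := hVR.trans hRB
  have hint := (integrable_L2B (mulOp hp w)).sub (integrable_normalizedIndicator (d := d) hR)
  have h1 : ∀ᵐ t ∂volume.restrict (unitBall d), ∫ y in unitBall d,
      Complex.exp (Complex.I * ((c * inner ℝ t y : ℝ) : ℂ)) *
        ((mulOp hp w : L2B d) y - normalizedIndicator R y) = 0 := by
    have hw' : expOp c (mulOp hp w) = phi c R := hw
    have e3 := coeFn_expOp c (mulOp hp w)
    rw [hw'] at e3
    filter_upwards [e3, (memLp_testFun c R).coeFn_toLp] with t e1 e2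
    simp only [mul_sub]
    rw [integral_sub (integrable_exp_mul c _ (integrable_L2B _) t)
      (integrable_exp_mul c _ (integrable_normalizedIndicator hR) t), ← e1,
      ← testFun_eq_setIntegral hRB, sub_eq_zero]
    exact e2
  -- Injectivity of `K` yields `p w = E` a.e. on the ball, which fails on `V`.
  have h2 := ae_restrict_eq_zero_of_expTransform_eq_zero hc hint Metric.isOpen_ball
    ⟨x, hRB hxR⟩ h1
  have hvolR : 0 < (volume R).toReal := by
    refine ENNReal.toReal_pos (((hVo.measure_pos volume hVne).trans_le (measure_mono hVR)).ne') ?_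
    exact ((measure_mono hRB).trans_lt measure_ball_lt_top).ne
  have h3 : ∀ᵐ y ∂volume.restrict V, False := by
    filter_upwards [ae_restrict_of_ae_restrict_of_subset hVB h2,
      ae_restrict_of_ae_restrict_of_subset hVB (coeFn_mulOp hp w), ae_restrict_of_ae hzero,
      ae_restrict_mem hVo.measurableSet] with y e1 e2 e3 hy
    have e4 : (mulOp hp w : L2B d) y - normalizedIndicator R y = 0 := e1
    rw [e2, e3 fun h => hy.2 (subset_closure h), normalizedIndicator,
      indicator_of_mem (hVR hy)] at e4
    have : (1 / (volume R).toReal : ℝ) ≠ 0 := by positivity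
    simp at e4
    exact absurd e4 (by simpa using this)
  rw [eventually_false_iff_eq_bot, ae_eq_bot, Measure.restrict_eq_zero] at h3
  exact (hVo.measure_pos volume hVne).ne' h3

end Range

end GLSM

end

/-! ### Assembly with `p = √q` -/

theorem mainTheorem3 (d : ℕ) (hd : d = 1 ∨ d = 2) (c : ℝ) (hc : 0 < c)
    (Ω : Set (EuclideanSpace ℝ (Fin d))) (hΩ_open : IsOpen Ω) (hΩ_ne : Ω.Nonempty)
    (hΩB : Ω ⊆ GLSM.unitBall d)
    (q : EuclideanSpace ℝ (Fin d) → ℝ) (hq : MemLp q ⊤ volume)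
    (hq_supp : ∀ᵐ x ∂(volume : Measure (EuclideanSpace ℝ (Fin d))), x ∉ Ω → q x = 0)
    (q_inf q_sup : ℝ) (hq_inf : 0 < q_inf)
    (hq_bounds : ∀ᵐ x ∂(volume.restrict Ω), q_inf ≤ q x ∧ q x ≤ q_sup) :
    (∃ (μ : ℕ → ℝ) (ζ : HilbertBasis ℕ ℂ (GLSM.L2B d)),
      GLSM.IsEigensystem (GLSM.dataOperator c q) μ ζ) ∧
    ∀ (μ : ℕ → ℝ) (ζ : HilbertBasis ℕ ℂ (GLSM.L2B d)),
      GLSM.IsEigensystem (GLSM.dataOperator c q) μ ζ →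
    ∀ f : ℝ → ℝ → ℝ, GLSM.IsRegularizingFilter f →
    ∀ R : Set (EuclideanSpace ℝ (Fin d)), MeasurableSet R → R.Nonempty →
      R ⊆ closure (interior R) → closure R ⊆ GLSM.unitBall d →
    (closure R ⊆ Ω →
      (∃ C : ℝ, ∀ α, 0 < α →
        ‖GLSM.glsmIndicator (GLSM.dataOperator c q)
          (GLSM.regularize μ ζ (f α) (GLSM.phi c R))‖ ≤ C) ∧
      ∃ g : GLSM.L2B d,
        (∀ g' : GLSM.L2B d,
          GLSM.opSqrt (GLSM.dataOperator c q) g' = GLSM.phi c R ↔ g' = g) ∧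
        Tendsto (fun α => GLSM.glsmIndicator (GLSM.dataOperator c q)
          (GLSM.regularize μ ζ (f α) (GLSM.phi c R))) (𝓝[>] 0) (𝓝 ((‖g‖ ^ 2 : ℝ) : ℂ))) ∧
    (¬ R ⊆ closure Ω →
      (∀ α, 0 < α → (GLSM.glsmIndicator (GLSM.dataOperator c q)
          (GLSM.regularize μ ζ (f α) (GLSM.phi c R))).im = 0) ∧
      Tendsto (fun α => (GLSM.glsmIndicator (GLSM.dataOperator c q)
          (GLSM.regularize μ ζ (f α) (GLSM.phi c R))).re) (𝓝[>] 0) atTop) := by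
  have hd0 : d ≠ 0 := by rcases hd with h | h <;> omega
  have hbd := (ae_restrict_iff' hΩ_open.measurableSet).1 hq_bounds
  have hq0 : ∀ᵐ y ∂(volume : Measure (EuclideanSpace ℝ (Fin d))), 0 ≤ q y := by
    filter_upwards [hbd, hq_supp] with y h1 h2
    by_cases hy : y ∈ Ω
    · exact hq_inf.le.trans (h1 hy).1
    · exact (h2 hy).ge
  have hp : MemLp (fun y => ((Real.sqrt (q y) : ℝ) : ℂ)) ⊤
      (volume.restrict (GLSM.unitBall d)) := by
    refine MemLp.restrict _ (memLp_top_of_bound ?_ (Real.sqrt q_sup) ?_)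
    · exact (Complex.continuous_ofReal.comp Real.continuous_sqrt).comp_aestronglyMeasurable hq.1
    · filter_upwards [hbd, hq_supp] with y h1 h2
      rw [Complex.norm_real, Real.norm_eq_abs, abs_of_nonneg (Real.sqrt_nonneg _)]
      by_cases hy : y ∈ Ω
      · exact Real.sqrt_le_sqrt (h1 hy).2
      · rw [h2 hy, Real.sqrt_zero]
        exact Real.sqrt_nonneg _
  have hN := GLSM.dataOperator_eq_factorOp_comp_adjoint c (q := q) hp
    (ae_restrict_of_ae (hq0.mono fun y hy => (Real.mul_self_sqrt hy).symm))
  have hlow : ∀ᵐ y ∂volume.restrict Ω, Real.sqrt q_inf ≤ Real.sqrt (q y) :=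
    hq_bounds.mono fun y hy => Real.sqrt_le_sqrt hy.1
  have hlow0 : 0 < Real.sqrt q_inf := Real.sqrt_pos.2 hq_inf
  have hpos : (GLSM.dataOperator c q).IsPositive := by
    rw [hN]; exact ContinuousLinearMap.isPositive_self_comp_adjoint _
  constructor
  · have hcomp : IsCompactOperator (GLSM.dataOperator c q) := by
      rw [hN]
      exact (GLSM.isCompactOperator_expOp c).comp_clm
        (GLSM.mulOp hp ∘L (GLSM.factorOp c hp).adjoint)
    have hinj : Function.Injective (GLSM.dataOperator c q) := by
      rw [injective_iff_map_eq_zero]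
      intro g hg
      refine GLSM.adjoint_factorOp_injective hc.ne' hp hΩ_open hΩ_ne hΩB
        (hlow.mono fun y hy => hlow0.trans_le hy) g ?_
      -- The kernels of `T T*` and `T*` agree, since `‖T* g‖² = ⟨T T* g, g⟩`.
      rw [← inner_self_eq_zero (𝕜 := ℂ), ContinuousLinearMap.adjoint_inner_right]
      have h1 : GLSM.factorOp c hp ((GLSM.factorOp c hp).adjoint g) = 0 := by
        rw [hN] at hg; exact hg
      rw [h1, inner_zero_left]
    obtain ⟨μ, ζ, h1, h2, h3⟩ := GLSM.exists_eigensystem hcomp hpos hinj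
      (GLSM.not_finiteDimensional_L2B hd0)
    exact ⟨μ, ζ, h1, h2, h3⟩
  · intro μ ζ hE f hf R hRm _ hRint hRB
    have hpicard := GLSM.mem_range_iff_summable hN hE.apply_eq hE.pos (GLSM.phi c R)
    constructor
    · intro hRΩ
      have hsum := hpicard.1 (GLSM.phi_mem_range_factorOp hp hRm (subset_closure.trans hRΩ)
        hΩ_open hΩB hlow0 hlow)
      obtain ⟨hbound, hlim⟩ := GLSM.glsmIndicator_bounded_tendsto hpos.isSymmetric hE hf hsum
      obtain ⟨g, hg, hgn⟩ := GLSM.exists_unique_sqrt_preimage hpos hE hsum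
      refine ⟨hbound, g, hg, ?_⟩
      rw [hgn]
      exact hlim
    · intro hRΩ
      refine GLSM.glsmIndicator_real_tendsto_atTop hpos.isSymmetric hE hf fun hsum => ?_
      refine GLSM.phi_notMem_range_factorOp hc.ne' hp hRm (subset_closure.trans hRB)
        hRint hRΩ ?_ (hpicard.2 hsum)
      filter_upwards [hq_supp] with y hy hyΩ
      rw [hy hyΩ, Real.sqrt_zero]
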